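/- **Setting.** Let $n\in\mathbb N$ and let $\mathfrak g=\mathfrak{su}(n)$ (traceless skew-Hermitian complex $n\times n$ matrices) with the inner product $\langle X,Y\rangle=\operatorname{Tr}X^*Y$; give $\mathfrak g\otimes\mathfrak g$ the induced inner product. *Littlewood–Paley operators.* Fix a radial $C^\infty$ function $\rho_0:\mathbb R^2\to[0,\infty)$ with $\operatorname{supp}\rho_0\subset\{1-\frac17\le|\xi|\le2\}$, $\rho_0(\xi)=1$ for $1\le|\xi|\le2-\frac27$, and $\rho_0(\xi)+\rho_0(\xi/2)=1$ for $1\le|\xi|\le4-\frac47$. Put $\rho_{-1}(\xi)=\sum_{i\le-1}\rho_0(2^{-i}\xi)$ for $\xi\ne0$, $\rho_{-1}(0)=1$, $\rho_i=\rho_0(2^{-i}\,\cdot)$ for $i\ge0$, and for $j\ge-1$ let $\chi_j=\sum_{i=-1}^{j-1}\rho_i$ (so $\chi_{-1}=0$) and $\mathbf S_ju=\mathcal F^{-1}(\chi_j\mathcal Fu)=\check\chi_j*u$, where $\mathcal Fu(z)=\int e^{-i\langle z,x\rangle}u(x)\,dx$ and $\check\chi_j=\mathcal F^{-1}\chi_j$.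 *White noise.* Let $(\Omega,\mathbb P)$ be a probability space and $W=(W(f))_{f\in L^2(\mathbb R^2)}$ a $\mathfrak g$-valued white noise: the family $(\langle W(f),X\rangle)_{f\in L^2(\mathbb R^2),X\in\mathfrak g}$ is a centred Gaussian process with $\mathbb E[\langle W(f),X\rangle\langle W(g),Y\rangle]=\langle f,g\rangle_{L^2}\langle X,Y\rangle$, and for every $\omega\in\Omega$ the restriction of $W_\omega$ to $\mathcal S(\mathbb R^2)$ is a $\mathfrak g$-valued tempered distribution. Let $W^{(j)}=\mathbf S_jW$, i.e. $W^{(j)}(x)=W(\check\chi_j(x-\cdot))$. *Curves.* Let $\mathfrak C$ be the set of smooth $\mathbf c=(\mathbf c_1,\mathbf c_2):\mathbb R\to\mathbb R^2$ with $\operatorname{supp}\dot{\mathbf c}\subset[0,1]$ and $\mathbf c_1(t)>0$ for all $t$. For $h\in L^\infty(\mathbb R)$ let $\mathcal E_{\mathbf c}h\in L^2(\mathbb R^2)$ be determined by $$\langle H,\mathcal E_{\mathbf c}h\rangle_{L^2}=\int_{\mathbb R}\int_0^{\mathbf c_1(t)}H(x_1,\mathbf c_2(t))\,h(t)\,\dot{\mathbf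 c}_2(t)\,dx_1\,dt\qquad(H\in L^2(\mathbb R^2)),$$ and let $\mathfrak C_\infty$ be the set of $\mathbf c\in\mathfrak C$ with $\sup\{\|\mathcal E_{\mathbf c}h\|_{L^\infty}:\|h\|_{L^\infty}\le1\}<\infty$. *Smoothed paths.* For $\mathbf c\in\mathfrak C$ and $j\ge-1$ let $A^{(j)}=A^{(j)}_2\,dx_2$ with $A_2^{(j)}(x)=\int_0^{x_1}W^{(j)}(\xi,x_2)\,d\xi$ (axial gauge), and let $$X^{(j)}_t=\int_{\mathbf c\restriction[0,t]}A^{(j)}=\int_0^tA_2^{(j)}(\mathbf c(\tau))\,\dot{\mathbf c}_2(\tau)\,d\tau,\qquad \mathbb X^{(j)}_{s,t}=\int_s^t(X^{(j)}_r-X^{(j)}_s)\otimes\dot X^{(j)}_r\,dr\in\mathfrak g\otimes\mathfrak g .$$ **Proposition 9.7.** For every $\mathbf c\in\mathfrak C_\infty$, all $s,t\in[0,1]$ and every $p\in[1,\infty)$, the sequence $(\mathbb X^{(j)}_{s,t})_{j\ge-1}$ lies in $L^p(\mathbb P,\mathfrak g\otimes\mathfrak g)$ and is Cauchy there: $$\lim_{j,j'\to\infty}\big\|\mathbb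 X^{(j')}_{s,t}-\mathbb X^{(j)}_{s,t}\big\|_{L^p(\mathbb P,\mathfrak g\otimes\mathfrak g)}=0 .$$ -/

import Mathlib

open MeasureTheory ProbabilityTheory Filter Topology
open scoped SchwartzMap ENNReal TensorProduct Matrix FourierTransform

namespace PlanarYM

/-- The Euclidean plane. Its coordinates `x_1, x_2` are `x 0` and `x 1`. -/
abbrev Plane : Type := EuclideanSpace ℝ (Fin 2)

/-! ### The Lie algebra `su(n)` with the Hilbert-Schmidt inner product -/

/-- The real vector space of traceless skew-Hermitian complex `n × n` matrices. -/
def suSubmodule (n : ℕ) : Submodule ℝ (Matrix (Fin n) (Fin n) ℂ) where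
  carrier := {X | Xᴴ = -X ∧ X.trace = 0}
  add_mem' := by
    rintro X Y ⟨hX, hX'⟩ ⟨hY, hY'⟩
    refine ⟨?_, ?_⟩
    · rw [Matrix.conjTranspose_add, hX, hY, neg_add]
    · rw [Matrix.trace_add, hX', hY', add_zero]
  zero_mem' := by simp
  smul_mem' := by
    rintro a X ⟨hX, hX'⟩
    refine ⟨?_, ?_⟩
    · rw [Matrix.conjTranspose_smul, hX]; simp
    · rw [Matrix.trace_smul, hX', smul_zero]

/-- The Lie algebra `su(n)`, as a type. -/
def Su (n : ℕ) : Type := ↥(suSubmodule n)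

namespace Su

noncomputable instance instAddCommGroup (n : ℕ) : AddCommGroup (Su n) :=
  inferInstanceAs (AddCommGroup ↥(suSubmodule n))

noncomputable instance instModule (n : ℕ) : Module ℝ (Su n) :=
  inferInstanceAs (Module ℝ ↥(suSubmodule n))

instance instFinite (n : ℕ) : Module.Finite ℝ (Su n) :=
  inferInstanceAs (Module.Finite ℝ ↥(suSubmodule n))

/-- The matrix underlying an element of `su(n)`. -/
def toMatrix {n : ℕ} (X : Su n) : Matrix (Fin n) (Fin n) ℂ := Subtype.val X

theorem toMatrix_add {n : ℕ} (X Y : Su n) : (X + Y).toMatrix = X.toMatrix + Y.toMatrix := rfl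

theorem toMatrix_smul {n : ℕ} (a : ℝ) (X : Su n) : (a • X).toMatrix = a • X.toMatrix := rfl

/-- `⟨X, Y⟩ = Tr (X^* Y)`; on `su(n)` the trace is real, so that taking the real part only
turns it into a real number. -/
@[reducible] noncomputable def innerCore (n : ℕ) : InnerProductSpace.Core ℝ (Su n) where
  inner X Y := (X.toMatrixᴴ * Y.toMatrix).trace.re
  conj_inner_symm X Y := by
    have h : (Y.toMatrixᴴ * X.toMatrix).trace = star (X.toMatrixᴴ * Y.toMatrix).trace := by
      rw [← Matrix.trace_conjTranspose, Matrix.conjTranspose_mul,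
        Matrix.conjTranspose_conjTranspose]
    simp [h]
  re_inner_nonneg X := by
    simp only [Matrix.trace, Matrix.diag_apply, Matrix.mul_apply, Matrix.conjTranspose_apply,
      Complex.re_sum, RCLike.re_to_real]
    refine Finset.sum_nonneg fun i _ => Finset.sum_nonneg fun j _ => ?_
    simp only [RCLike.star_def, Complex.mul_re, Complex.conj_re, Complex.conj_im]
    nlinarith [mul_self_nonneg (X.toMatrix j i).re, mul_self_nonneg (X.toMatrix j i).im]
  add_left X Y Z := by
    rw [toMatrix_add, Matrix.conjTranspose_add, add_mul, Matrix.trace_add, Complex.add_re]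
  smul_left X Y a := by
    rw [toMatrix_smul, Matrix.conjTranspose_smul, Matrix.smul_mul, Matrix.trace_smul]
    simp
  definite X h := by
    have key : ∀ i ∈ Finset.univ, ∀ j ∈ Finset.univ, X.toMatrix j i = 0 := by
      simp only [Matrix.trace, Matrix.diag_apply, Matrix.mul_apply, Matrix.conjTranspose_apply,
        Complex.re_sum, RCLike.star_def, Complex.mul_re, Complex.conj_re, Complex.conj_im] at h
      have hn : ∀ i j, 0 ≤ (X.toMatrix j i).re * (X.toMatrix j i).re
          - -(X.toMatrix j i).im * (X.toMatrix j i).im := fun i j => by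
        nlinarith [mul_self_nonneg (X.toMatrix j i).re, mul_self_nonneg (X.toMatrix j i).im]
      intro i hi j hj
      have h1 := (Finset.sum_eq_zero_iff_of_nonneg
        (fun i _ => Finset.sum_nonneg fun j _ => hn i j)).1 h i hi
      have h2 := (Finset.sum_eq_zero_iff_of_nonneg (fun j _ => hn i j)).1 h1 j hj
      apply Complex.ext
      · simp only [Complex.zero_re]
        nlinarith [mul_self_nonneg (X.toMatrix j i).re, mul_self_nonneg (X.toMatrix j i).im]
      · simp only [Complex.zero_im]
        nlinarith [mul_self_nonneg (X.toMatrix j i).re, mul_self_nonneg (X.toMatrix j i).im]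
    exact Subtype.ext (Matrix.ext fun j i => key i (Finset.mem_univ i) j (Finset.mem_univ j))

noncomputable instance instNormedAddCommGroup (n : ℕ) : NormedAddCommGroup (Su n) :=
  (innerCore n).toNormedAddCommGroup

noncomputable instance instInnerProductSpace (n : ℕ) : InnerProductSpace ℝ (Su n) :=
  InnerProductSpace.ofCore (innerCore n).toCore

theorem inner_eq {n : ℕ} (X Y : Su n) :
    inner ℝ X Y = (X.toMatrixᴴ * Y.toMatrix).trace.re := rfl

end Su

/-! ### Littlewood-Paley operators -/

/-- A function `ρ_0` generating a dyadic partition of unity. -/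
structure LPCutoff where
  toFun : Plane → ℝ
  smooth : ContDiff ℝ (⊤ : ℕ∞) toFun
  radial : ∀ ξ η : Plane, ‖ξ‖ = ‖η‖ → toFun ξ = toFun η
  nonneg : ∀ ξ, 0 ≤ toFun ξ
  support : tsupport toFun ⊆ {ξ | 1 - 1 / 7 ≤ ‖ξ‖ ∧ ‖ξ‖ ≤ 2}
  eq_one : ∀ ξ, 1 ≤ ‖ξ‖ → ‖ξ‖ ≤ 2 - 2 / 7 → toFun ξ = 1
  add_eq_one : ∀ ξ, 1 ≤ ‖ξ‖ → ‖ξ‖ ≤ 4 - 4 / 7 → toFun ξ + toFun ((1 / 2 : ℝ) • ξ) = 1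

namespace LPCutoff

/-- `χ_0(ξ) = ∑_{j ≤ -1} ρ_0(2^{-j} ξ)` for `ξ ≠ 0` (the summation index is `j = -(k + 1)`), and
`χ_0(0) = 1`. -/
noncomputable def chi₀ (ρ : LPCutoff) (ξ : Plane) : ℝ :=
  open Classical in if ξ = 0 then 1 else ∑' k : ℕ, ρ.toFun ((2 : ℝ) ^ (k + 1) • ξ)

/-- `ρ_{-1} = χ_0` and `ρ_j = ρ_0(2^{-j} ·)` for `j ≥ 0`. -/
noncomputable def block (ρ : LPCutoff) (j : ℤ) (ξ : Plane) : ℝ :=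
  if j = -1 then ρ.chi₀ ξ else ρ.toFun ((2 : ℝ) ^ (-j) • ξ)

/-- `χ_j = ∑_{i = -1}^{j - 1} ρ_i`, the symbol of the operator `S_j = ∑_{i = -1}^{j - 1} Δ_i`
(for `j = -1` the sum is empty). -/
noncomputable def chi (ρ : LPCutoff) (j : ℤ) (ξ : Plane) : ℝ :=
  ∑ i ∈ Finset.Ico (-1) j, ρ.block i ξ

theorem eq_zero_of_lt (ρ : LPCutoff) {ξ : Plane} (h : ‖ξ‖ < 6 / 7) : ρ.toFun ξ = 0 := by
  by_contra h0
  have h1 : 1 - 1 / 7 ≤ ‖ξ‖ ∧ ‖ξ‖ ≤ 2 := ρ.support (subset_tsupport _ h0)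
  linarith [h1.1]

theorem eq_zero_of_gt (ρ : LPCutoff) {ξ : Plane} (h : 2 < ‖ξ‖) : ρ.toFun ξ = 0 := by
  by_contra h0
  have h1 : 1 - 1 / 7 ≤ ‖ξ‖ ∧ ‖ξ‖ ≤ 2 := ρ.support (subset_tsupport _ h0)
  linarith [h1.2]

theorem hasCompactSupport (ρ : LPCutoff) : HasCompactSupport ρ.toFun := by
  refine HasCompactSupport.of_support_subset_isCompact (isCompact_closedBall (0 : Plane) 2) ?_
  intro ξ hξ
  have h1 := ρ.support (subset_tsupport _ hξ)
  simpa using h1.2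

theorem norm_two_pow_smul (k : ℕ) (ξ : Plane) : ‖(2 : ℝ) ^ k • ξ‖ = 2 ^ k * ‖ξ‖ := by
  rw [norm_smul, norm_pow, Real.norm_ofNat]

/-- `χ_0 = 1` near the origin. -/
theorem chi₀_eq_one (ρ : LPCutoff) {ξ : Plane} (h : ‖ξ‖ < 6 / 7) : ρ.chi₀ ξ = 1 := by
  classical
  unfold chi₀
  split_ifs with h0
  · rfl
  have hpos : 0 < ‖ξ‖ := norm_pos_iff.2 h0
  have hex : ∃ m : ℕ, 6 / 7 ≤ 2 ^ m * ‖ξ‖ := by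
    obtain ⟨m, hm⟩ := pow_unbounded_of_one_lt (6 / 7 / ‖ξ‖) (one_lt_two : (1 : ℝ) < 2)
    exact ⟨m, by rw [div_lt_iff₀ hpos] at hm; exact hm.le⟩
  have hm := Nat.find_spec hex
  have hmin := fun k (hk : k < Nat.find hex) => not_le.1 (Nat.find_min hex hk)
  generalize Nat.find hex = m at hm hmin
  obtain _ | m := m
  · simp only [pow_zero, one_mul] at hm; linarith
  have hlt := hmin m (Nat.lt_succ_self m)
  have hs : ∀ k ∉ ({m, m + 1} : Finset ℕ), ρ.toFun ((2 : ℝ) ^ (k + 1) • ξ) = 0 := by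
    intro k hk
    simp only [Finset.mem_insert, Finset.mem_singleton, not_or] at hk
    rcases lt_or_gt_of_ne hk.1 with hkm | hkm
    · apply ρ.eq_zero_of_lt
      rw [norm_two_pow_smul]
      exact hmin _ (by omega)
    · apply ρ.eq_zero_of_gt
      rw [norm_two_pow_smul]
      have h3 : (2 : ℝ) ^ (m + 3) ≤ 2 ^ (k + 1) := pow_le_pow_right₀ one_le_two (by omega)
      have h4 := mul_le_mul_of_nonneg_right h3 hpos.le
      have h5 : (2 : ℝ) ^ (m + 3) = 4 * 2 ^ (m + 1) := by ring
      rw [h5] at h4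
      nlinarith
  rw [tsum_eq_sum hs, Finset.sum_pair (by omega), add_comm]
  have h2 : (2 : ℝ) ^ (m + 1) • ξ = (1 / 2 : ℝ) • ((2 : ℝ) ^ (m + 1 + 1) • ξ) := by
    rw [smul_smul]; congr 1; ring
  rw [h2]
  have h6 : (2 : ℝ) ^ (m + 1) = 2 * 2 ^ m := by ring
  have h7 : (2 : ℝ) ^ (m + 1 + 1) = 4 * 2 ^ m := by ring
  rw [h6] at hm
  apply ρ.add_eq_one
  · rw [norm_two_pow_smul, h7]; nlinarith
  · rw [norm_two_pow_smul, h7]; nlinarith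

/-- `χ_0 = ρ_0(2 ·)` away from the origin. -/
theorem chi₀_eq_of_gt (ρ : LPCutoff) {ξ : Plane} (h : 1 / 2 < ‖ξ‖) :
    ρ.chi₀ ξ = ρ.toFun ((2 : ℝ) • ξ) := by
  classical
  unfold chi₀
  have h0 : ξ ≠ 0 := by rintro rfl; norm_num at h
  rw [if_neg h0, tsum_eq_single 0]
  · simp
  · intro k hk
    apply ρ.eq_zero_of_gt
    rw [norm_two_pow_smul]
    have h3 : (2 : ℝ) ^ 2 ≤ 2 ^ (k + 1) := pow_le_pow_right₀ one_le_two (by omega)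
    nlinarith

theorem contDiff_chi₀ (ρ : LPCutoff) : ContDiff ℝ (⊤ : ℕ∞) ρ.chi₀ := by
  rw [contDiff_iff_contDiffAt]
  intro ξ
  rcases lt_or_ge ‖ξ‖ (6 / 7) with h | h
  · refine (contDiffAt_const (c := (1 : ℝ))).congr_of_eventuallyEq ?_
    filter_upwards [(isOpen_lt continuous_norm continuous_const).mem_nhds h] with η hη
    exact ρ.chi₀_eq_one hη
  · have h' : 1 / 2 < ‖ξ‖ := by linarith
    refine ((ρ.smooth.comp (contDiff_const_smul (2 : ℝ))).contDiffAt).congr_of_eventuallyEq ?_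
    filter_upwards [(isOpen_lt continuous_const continuous_norm).mem_nhds h'] with η hη
    exact ρ.chi₀_eq_of_gt hη

theorem hasCompactSupport_chi₀ (ρ : LPCutoff) : HasCompactSupport ρ.chi₀ := by
  refine HasCompactSupport.intro (isCompact_closedBall (0 : Plane) 1) ?_
  intro ξ hξ
  have h1 : 1 < ‖ξ‖ := by simpa using hξ
  rw [ρ.chi₀_eq_of_gt (by linarith)]
  apply ρ.eq_zero_of_gt
  rw [norm_smul, Real.norm_ofNat]
  linarith

theorem contDiff_chi (ρ : LPCutoff) (j : ℤ) : ContDiff ℝ (⊤ : ℕ∞) (ρ.chi j) := by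
  unfold chi
  refine ContDiff.sum fun i _ => ?_
  unfold block
  split_ifs
  · exact ρ.contDiff_chi₀
  · exact ρ.smooth.comp (contDiff_const_smul ((2 : ℝ) ^ (-i)))

theorem hasCompactSupport_chi (ρ : LPCutoff) (j : ℤ) : HasCompactSupport (ρ.chi j) := by
  unfold chi
  have hb : ∀ i, HasCompactSupport (ρ.block i) := by
    intro i
    unfold block
    split_ifs
    · exact ρ.hasCompactSupport_chi₀
    · exact ρ.hasCompactSupport.comp_smul (zpow_ne_zero _ two_ne_zero)
  classical
  induction Finset.Ico (-1) j using Finset.induction_on with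
  | empty =>
    simp only [Finset.sum_empty]
    exact (HasCompactSupport.zero : HasCompactSupport (0 : Plane → ℝ))
  | insert a s ha ih =>
    simp only [Finset.sum_insert ha]
    exact (hb a).add ih

/-- The inverse Fourier transform, with the convention `û(z) = ∫ e^{-i⟨z, x⟩} u(x) dx`. -/
noncomputable def invFourier (u : Plane → ℝ) (x : Plane) : ℂ :=
  ((2 * Real.pi) ^ 2 : ℝ)⁻¹ • ∫ z : Plane, Complex.exp (Complex.I * (inner ℝ z x : ℝ)) * (u z : ℂ)

/-- `χ_j` as a complex Schwartz function. -/
noncomputable def chiSchwartz (ρ : LPCutoff) (j : ℤ) : 𝓢(Plane, ℂ) :=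
  HasCompactSupport.toSchwartzMap (f := fun z => ((ρ.chi j z : ℝ) : ℂ))
    ((ρ.hasCompactSupport_chi j).comp_left (g := ((↑) : ℝ → ℂ)) Complex.ofReal_zero)
    (Complex.ofRealCLM.contDiff.comp (ρ.contDiff_chi j))

/-- The inverse Fourier transform above, through Mathlib's. -/
noncomputable def kernelAux (ρ : LPCutoff) (j : ℤ) : 𝓢(Plane, ℝ) :=
  SchwartzMap.postcompCLM (𝕜 := ℝ) Complex.reCLM
    (((2 * Real.pi) ^ 2 : ℝ)⁻¹ • SchwartzMap.compCLMOfContinuousLinearEquiv ℝ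
      (ContinuousLinearEquiv.smulLeft
        (Units.mk0 (2 * Real.pi)⁻¹ (inv_ne_zero Real.two_pi_pos.ne'))) (𝓕⁻ (ρ.chiSchwartz j)))

theorem kernelAux_apply (ρ : LPCutoff) (j : ℤ) (x : Plane) :
    ρ.kernelAux j x = (invFourier (ρ.chi j) x).re := by
  have h1 : ρ.kernelAux j x = (((2 * Real.pi) ^ 2 : ℝ)⁻¹ •
      (𝓕⁻ (ρ.chiSchwartz j)) ((2 * Real.pi)⁻¹ • x)).re := rfl
  have h2 : (𝓕⁻ (ρ.chiSchwartz j)) ((2 * Real.pi)⁻¹ • x)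
      = ∫ z : Plane, Complex.exp (Complex.I * (inner ℝ z x : ℝ)) * (ρ.chi j z : ℂ) := by
    rw [SchwartzMap.fourierInv_coe, Real.fourierInv_eq']
    refine integral_congr_ae (Eventually.of_forall fun z => ?_)
    have h3 : (ρ.chiSchwartz j) z = (ρ.chi j z : ℂ) := rfl
    simp only [h3, smul_eq_mul, inner_smul_right]
    congr 2
    have hpi := Real.pi_ne_zero
    rw [mul_comm]
    congr 2
    field_simp
  rw [h1, h2, invFourier]

/-- The convolution kernel `F^{-1} χ_j` of the operator `S_j`, a real Schwartz function
(as `χ_j` is even, its inverse Fourier transform is real). -/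
noncomputable def kernel (ρ : LPCutoff) (j : ℤ) : 𝓢(Plane, ℝ) where
  toFun x := (invFourier (ρ.chi j) x).re
  smooth' := by
    have h := (ρ.kernelAux j).smooth'
    rwa [show (ρ.kernelAux j).toFun = fun x => (invFourier (ρ.chi j) x).re from
      funext (ρ.kernelAux_apply j)] at h
  decay' := by
    have h := (ρ.kernelAux j).decay'
    rwa [show (ρ.kernelAux j).toFun = fun x => (invFourier (ρ.chi j) x).re from
      funext (ρ.kernelAux_apply j)] at h

/-- The Schwartz function `y ↦ (F^{-1} χ_j)(x - y)`. -/
noncomputable def kernelAt (ρ : LPCutoff) (j : ℤ) (x : Plane) : 𝓢(Plane, ℝ) :=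
  SchwartzMap.compSubConstCLM ℝ x (SchwartzMap.compCLMOfContinuousLinearEquiv ℝ
    (ContinuousLinearEquiv.neg ℝ) (ρ.kernel j))

theorem kernelAt_apply (ρ : LPCutoff) (j : ℤ) (x y : Plane) :
    ρ.kernelAt j x y = (invFourier (ρ.chi j) (x - y)).re := by
  rw [← neg_sub y x]
  rfl

end LPCutoff

/-! ### White noise -/

/-- `W` is an `su(n)`-valued Gaussian white noise on the plane: a centred Gaussian family with
`E[⟨W(f), X⟩ ⟨W(g), Y⟩] = ⟨f, g⟩_{L²} ⟨X, Y⟩`, that is, `E[W(f)_k W(g)_l] = δ_{kl} ⟨f, g⟩_{L²}` in an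
orthonormal basis, of which every realization restricts to a tempered distribution. -/
structure IsWhiteNoise {n : ℕ} {Ω : Type*} [MeasurableSpace Ω] (P : Measure Ω)
    (W : Lp ℝ 2 (volume : Measure Plane) → Ω → Su n) : Prop where
  memLp : ∀ f, MemLp (W f) 2 P
  gaussian : IsGaussianProcess
    (fun (q : Lp ℝ 2 (volume : Measure Plane) × Su n) ω => inner ℝ (W q.1 ω) q.2) P
  centered : ∀ f X, ∫ ω, inner ℝ (W f ω) X ∂P = 0
  covariance : ∀ f g X Y,
    ∫ ω, inner ℝ (W f ω) X * inner ℝ (W g ω) Y ∂P = inner ℝ f g * inner ℝ X Y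
  tempered : ∀ ω, ∃ T : 𝓢(Plane, ℝ) →L[ℝ] Su n,
    ∀ φ : 𝓢(Plane, ℝ), T φ = W (φ.toLp 2 volume) ω

/-- The smooth approximation `W^{(j)} = S_j W`, `W^{(j)}(x) = ⟨W, (F^{-1} χ_j)(x - ·)⟩`. -/
noncomputable def smoothedNoise {n : ℕ} {Ω : Type*} (ρ : LPCutoff)
    (W : Lp ℝ 2 (volume : Measure Plane) → Ω → Su n) (j : ℤ) (ω : Ω) (x : Plane) : Su n :=
  W ((ρ.kernelAt j x).toLp 2 volume) ω

/-! ### Curves, gauge fields and iterated integrals -/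

/-- The set of smooth curves in the right half plane with `supp c' ⊆ [0, 1]`. -/
def Curves : Set (ℝ → Plane) :=
  {c | ContDiff ℝ (⊤ : ℕ∞) c ∧ tsupport (deriv c) ⊆ Set.Icc 0 1 ∧ ∀ t, 0 < c t 0}

/-- The gauge field `A = A_1 dx_1 + A_2 dx_2` in axial gauge with field strength `F`: `A_1 = 0` and
`A_2(x) = ∫_0^{x_1} F(ξ, x_2) dξ`. -/
noncomputable def axialField {n : ℕ} (F : Plane → Su n) : Fin 2 → Plane → Su n :=
  ![fun _ => 0, fun x => ∫ ξ in (0 : ℝ)..x 0, F !₂[ξ, x 1]]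

/-- The line integral of `A` along the restriction of `c` to `[0, t]`. -/
noncomputable def lineIntegral {n : ℕ} (c : ℝ → Plane) (A : Fin 2 → Plane → Su n) (t : ℝ) : Su n :=
  ∫ τ in (0 : ℝ)..t, ∑ k, deriv c τ k • A k (c τ)

/-- The path `X^{(j)}_t`. -/
noncomputable def path {n : ℕ} {Ω : Type*} (ρ : LPCutoff)
    (W : Lp ℝ 2 (volume : Measure Plane) → Ω → Su n) (c : ℝ → Plane) (j : ℤ) (ω : Ω) (t : ℝ) :
    Su n :=
  lineIntegral c (axialField (smoothedNoise ρ W j ω)) t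

/-- The second-level iterated integral `∫_s^t (X_r - X_s) ⊗ dX_r` of the path `X^{(j)}`. -/
noncomputable def secondLevel {n : ℕ} {Ω : Type*} (ρ : LPCutoff)
    (W : Lp ℝ 2 (volume : Measure Plane) → Ω → Su n) (c : ℝ → Plane) (j : ℤ) (s t : ℝ) (ω : Ω) :
    Su n ⊗[ℝ] Su n :=
  ∫ r in s..t, (path ρ W c j ω r - path ρ W c j ω s) ⊗ₜ[ℝ] deriv (path ρ W c j ω) r

/-! ### The operator attached to a curve -/

/-- `∫_ℝ ∫_0^{c_1(t)} H(x_1, c_2(t)) h(t) c_2'(t) dx_1 dt`. -/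
noncomputable def hatE (c : ℝ → Plane) (H : Plane → ℝ) (h : ℝ → ℝ) : ℝ :=
  ∫ t, ∫ x₁ in (0 : ℝ)..c t 0, H !₂[x₁, c t 1] * h t * deriv c t 1

/-- `u` is (a representative of) `E_c h`, the element of `L²` that represents the linear functional
`H ↦ hatE c H h`. -/
def IsImageE (c : ℝ → Plane) (h : ℝ → ℝ) (u : Plane → ℝ) : Prop :=
  MemLp u 2 ∧ ∀ H : Plane → ℝ, MemLp H 2 → ∫ x, H x * u x = hatE c H h

/-- The curves for which `sup {‖E_c h‖_{L^∞} : ‖h‖_{L^∞} ≤ 1}` is finite. -/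
def CurvesInfty : Set (ℝ → Plane) :=
  {c | c ∈ Curves ∧ ∃ M : ℝ, ∀ h : ℝ → ℝ, MemLp h ∞ → eLpNorm h ∞ ≤ 1 →
    ∃ u, IsImageE c h u ∧ eLpNorm u ∞ ≤ ENNReal.ofReal M}

end PlanarYM

namespace PlanarYM

/-! In an orthonormal basis of $\mathfrak{su}(n)$ the components of white noise are isonormal
Gaussian processes $V_k$ on $L^2(\mathbb R^2)$, independent for different $k$. After mapping the
segment from $s$ to $t$ affinely onto $[0,1]$, the $k$-th component of $\dot X^{(j)}$ is a
continuous version of $V_k(f_j(u))$ for a deterministic continuous curve $f_j$ in $L^2$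
(`noiseComponent_ae_eq`). The coefficients of $\mathbb X^{(j)}_{s,t}$ are therefore iterated
integrals of such processes (`secondLevel_eq`).

A diagonal coefficient is half the square of $V_k(\int_0^1 f_j)$, so it converges as soon as
$\int_0^1 f_j$ does. For an off-diagonal coefficient the integral is compared with its
Riemann-Stieltjes sum of $N$ steps. The difference between a fine and a coarse sum is a bilinear
form $\sum_i V_1(v_i)V_2(g_i)$ with independent factors. Freezing $V_1$ leaves a Gaussian variable,
whose variance is controlled by the almost orthogonality of the increments $g_i$ (`StepBound`),
while the $v_i$ have norm at most $\sqrt{K/N}$ (`eLpNorm_sum_mul_le`). The error is thus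
$O(N^{-1/2})$ uniformly in $j\ge 0$. For fixed $N$ the sum involves finitely many vectors $\int_0^u
f_j$, which converge in $L^2$, and a three-epsilon argument concludes
(`tendsto_eLpNorm_iterated_sub`).

The analytic inputs come from the identity that $\int h\,\dot X^{(j)}$ corresponds to the smoothing
of $\mathcal E_{\mathbf c}h$ by $\check\chi_j$ (`integral_smul_velocity`). For $j\ge0$ the kernels
are dilations of $\check\chi_0$, so the smoothings are uniformly bounded on $L^2$ and converge
strongly. The hypothesis $\mathbf c\in\mathfrak C_\infty$ enters through `exists_image_norm_le`:
boundedness of $\mathcal E_{\mathbf c}$ on $L^\infty$ implies boundedness on $L^2$. Together they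
give the limits and a step bound with one constant for all $j\ge0$. -/

/-! ### Isonormal Gaussian processes -/

/-- `V` is an isonormal Gaussian process indexed by the real Hilbert space `H`. -/
structure IsIsonormal {Ω H : Type*} [MeasurableSpace Ω] [NormedAddCommGroup H]
    [InnerProductSpace ℝ H] (P : Measure Ω) (V : H → Ω → ℝ) : Prop where
  law : ∀ f, HasGaussianLaw (V f) P
  centered : ∀ f, ∫ ω, V f ω ∂P = 0
  covariance : ∀ f g, ∫ ω, V f ω * V g ω ∂P = inner ℝ f g

/-- The `L^p` norm of a standard Gaussian variable. -/
noncomputable def gaussianNorm (p : ℝ≥0∞) : ℝ≥0∞ := eLpNorm id p (gaussianReal 0 1)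

theorem gaussianNorm_ne_top {p : ℝ≥0∞} (hp : p ≠ ∞) : gaussianNorm p ≠ ∞ := by
  lift p to NNReal using hp
  exact (memLp_id_gaussianReal p).eLpNorm_ne_top

namespace IsIsonormal

variable {Ω H : Type*} [MeasurableSpace Ω] [NormedAddCommGroup H] [InnerProductSpace ℝ H]
  {P : Measure Ω} {V V₁ V₂ : H → Ω → ℝ}

theorem aemeasurable (hV : IsIsonormal P V) (f : H) : AEMeasurable (V f) P :=
  (hV.law f).aemeasurable

theorem aestronglyMeasurable (hV : IsIsonormal P V) (f : H) : AEStronglyMeasurable (V f) P :=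
  (hV.aemeasurable f).aestronglyMeasurable

theorem memLp (hV : IsIsonormal P V) (f : H) {p : ℝ≥0∞} (hp : p ≠ ∞) : MemLp (V f) p P :=
  (hV.law f).memLp hp

theorem integral_sq (hV : IsIsonormal P V) (f : H) : ∫ ω, V f ω ^ 2 ∂P = ‖f‖ ^ 2 := by
  have := hV.covariance f f
  rw [real_inner_self_eq_norm_sq] at this
  simpa [sq] using this

theorem map_eq (hV : IsIsonormal P V) (f : H) :
    P.map (V f) = (gaussianReal 0 1).map (fun x => ‖f‖ * x) := by
  rw [(hV.law f).map_eq_gaussianReal, hV.centered,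
    variance_of_integral_eq_zero (hV.aemeasurable f) (hV.centered f), hV.integral_sq,
    gaussianReal_map_const_mul, mul_zero]
  congr 1
  ext
  simp

/-- The law of `V f` is that of `‖f‖` times a standard Gaussian. Every moment estimate below thereby
becomes an estimate of norms in `H`. -/
theorem eLpNorm_eq (hV : IsIsonormal P V) (f : H) (p : ℝ≥0∞) :
    eLpNorm (V f) p P = ‖f‖ₑ * gaussianNorm p := by
  have h1 : eLpNorm (V f) p P = eLpNorm id p (P.map (V f)) := by
    rw [eLpNorm_map_measure aestronglyMeasurable_id (hV.aemeasurable f)]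
    rfl
  rw [h1, hV.map_eq, eLpNorm_map_measure aestronglyMeasurable_id (by fun_prop)]
  have h2 : (id ∘ fun x : ℝ => ‖f‖ * x) = ‖f‖ • (id : ℝ → ℝ) := by
    ext x; simp
  rw [h2, eLpNorm_const_smul, enorm_norm]
  rfl

theorem lintegral_enorm_pow (hV : IsIsonormal P V) (f : H) {q : ℕ} (hq : q ≠ 0) :
    ∫⁻ ω, ‖V f ω‖ₑ ^ q ∂P = (‖f‖ₑ * gaussianNorm q) ^ q := by
  have h := eLpNorm_nnreal_pow_eq_lintegral (μ := P) (f := V f) (p := q) (by simpa using hq)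
  simp only [NNReal.coe_natCast, ENNReal.rpow_natCast] at h
  rw [← h, ← hV.eLpNorm_eq]
  rfl

/-- Linearity is not part of the definition; the covariance forces it. Expanding the square of the
difference and inserting the covariances gives expectation zero. -/
theorem sum_ae (hV : IsIsonormal P V) {ι : Type*} (s : Finset ι) (a : ι → ℝ) (f : ι → H) :
    V (∑ i ∈ s, a i • f i) =ᵐ[P] fun ω => ∑ i ∈ s, a i * V (f i) ω := by
  have hm : ∀ g, MemLp (V g) 2 P := fun g => hV.memLp g (by simp)
  have hint : ∀ g g', Integrable (fun ω => V g ω * V g' ω) P :=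
    fun g g' => (hm g).integrable_mul (hm g')
  set F := ∑ i ∈ s, a i • f i with hF
  have hsum : MemLp (fun ω => ∑ i ∈ s, a i * V (f i) ω) 2 P :=
    memLp_finsetSum _ fun i _ => (hm (f i)).const_mul (a i)
  have h0 : ∫ ω, (V F ω - ∑ i ∈ s, a i * V (f i) ω) ^ 2 ∂P = 0 := by
    have h1 : ∀ ω, (V F ω - ∑ i ∈ s, a i * V (f i) ω) ^ 2 =
        V F ω * V F ω - 2 * (∑ i ∈ s, a i * (V F ω * V (f i) ω)) +
          ∑ i ∈ s, ∑ k ∈ s, a i * a k * (V (f i) ω * V (f k) ω) := by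
      intro ω
      have h2 : ∑ i ∈ s, a i * (V F ω * V (f i) ω) = V F ω * ∑ i ∈ s, a i * V (f i) ω := by
        rw [Finset.mul_sum]; exact Finset.sum_congr rfl fun _ _ => by ring
      have h3 : ∑ i ∈ s, ∑ k ∈ s, a i * a k * (V (f i) ω * V (f k) ω) =
          (∑ i ∈ s, a i * V (f i) ω) * ∑ k ∈ s, a k * V (f k) ω := by
        rw [Finset.sum_mul_sum]
        exact Finset.sum_congr rfl fun _ _ => Finset.sum_congr rfl fun _ _ => by ring
      rw [h2, h3]; ring
    simp_rw [h1]
    have i1 : Integrable (fun ω => ∑ i ∈ s, a i * (V F ω * V (f i) ω)) P :=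
      integrable_finsetSum _ fun i _ => (hint _ _).const_mul _
    have i2 : Integrable (fun ω => ∑ i ∈ s, ∑ k ∈ s, a i * a k * (V (f i) ω * V (f k) ω)) P :=
      integrable_finsetSum _ fun i _ => integrable_finsetSum _ fun k _ => (hint _ _).const_mul _
    have i3 : Integrable
        (fun ω => V F ω * V F ω - 2 * ∑ i ∈ s, a i * (V F ω * V (f i) ω)) P :=
      (hint F F).sub (i1.const_mul 2)
    rw [integral_add i3 i2,
      integral_sub (hint F F) (i1.const_mul 2), integral_const_mul,
      integral_finsetSum _ (fun i _ => (hint _ _).const_mul _),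
      integral_finsetSum _
        (fun i _ => integrable_finsetSum _ fun k _ => (hint _ _).const_mul _)]
    simp_rw [integral_finsetSum s (fun k (_ : k ∈ s) => (hint (f _) (f k)).const_mul _),
      integral_const_mul, hV.covariance]
    have e1 : ∑ i ∈ s, a i * inner ℝ F (f i) = inner ℝ F F := by
      conv_rhs => rw [hF, inner_sum]
      exact Finset.sum_congr rfl fun i _ => by rw [inner_smul_right, ← hF]
    have e2 : ∑ i ∈ s, ∑ k ∈ s, a i * a k * inner ℝ (f i) (f k) = inner ℝ F F := by
      rw [hF, sum_inner]
      refine Finset.sum_congr rfl fun i _ => ?_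
      rw [inner_sum]
      exact Finset.sum_congr rfl fun k _ => by
        rw [inner_smul_right, real_inner_smul_left]; ring
    rw [e1, e2]; ring
  have hd : Integrable (fun ω => (V F ω - ∑ i ∈ s, a i * V (f i) ω) ^ 2) P :=
    ((hm F).sub hsum).integrable_sq
  rw [integral_eq_zero_iff_of_nonneg (fun _ => sq_nonneg _) hd] at h0
  filter_upwards [h0] with ω hω
  have : V F ω - ∑ i ∈ s, a i * V (f i) ω = 0 := by simpa using hω
  linarith

theorem sub_ae (hV : IsIsonormal P V) (f g : H) :
    V (f - g) =ᵐ[P] fun ω => V f ω - V g ω := by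
  have h := hV.sum_ae Finset.univ ![1, -1] ![f, g]
  simp only [Fin.sum_univ_two, Matrix.cons_val_zero, Matrix.cons_val_one, one_smul, neg_smul,
    one_mul, neg_mul] at h
  simpa [sub_eq_add_neg] using h

theorem smul_ae (hV : IsIsonormal P V) (a : ℝ) (f : H) :
    V (a • f) =ᵐ[P] fun ω => a * V f ω := by
  simpa using hV.sum_ae Finset.univ (fun _ : Unit => a) (fun _ => f)

theorem eLpNorm_sub (hV : IsIsonormal P V) (f g : H) (p : ℝ≥0∞) :
    eLpNorm (fun ω => V f ω - V g ω) p P = ‖f - g‖ₑ * gaussianNorm p := by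
  rw [← hV.eLpNorm_eq, eLpNorm_congr_ae (hV.sub_ae f g)]

/-- Convergence in `H` forces every pointwise limit of the process. -/
theorem ae_eq_of_tendsto (hV : IsIsonormal P V) {g : ℕ → H} {f : H}
    (hg : Tendsto g atTop (𝓝 f)) {Y : Ω → ℝ}
    (hY : ∀ᵐ ω ∂P, Tendsto (fun N => V (g N) ω) atTop (𝓝 (Y ω))) : Y =ᵐ[P] V f := by
  have h1 : TendstoInMeasure P (fun N => V (g N)) atTop (V f) := by
    refine tendstoInMeasure_of_tendsto_eLpNorm (p := 1) one_ne_zero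
      (fun N => hV.aestronglyMeasurable _) (hV.aestronglyMeasurable _) ?_
    have h2 : ∀ N, eLpNorm (V (g N) - V f) 1 P = ‖g N - f‖ₑ * gaussianNorm 1 :=
      fun N => hV.eLpNorm_sub _ _ _
    simp_rw [h2]
    have h3 : Tendsto (fun N => ‖g N - f‖ₑ) atTop (𝓝 0) := by
      have := (continuous_enorm.tendsto _).comp (hg.sub_const f)
      simpa [Function.comp_def] using this
    simpa using ENNReal.Tendsto.mul_const h3 (Or.inr (gaussianNorm_ne_top (by simp)))
  -- Along a subsequence `V (g N)` converges almost surely to `V f`, and this limit must be `Y`.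
  obtain ⟨ns, hns, h⟩ := h1.exists_seq_tendsto_ae
  filter_upwards [h, hY] with ω h1 h2
  exact tendsto_nhds_unique (h2.comp hns.tendsto_atTop) h1

end IsIsonormal

/-! ### Riemann sums -/

theorem tendsto_sum_integral_smul {E : Type*} [NormedAddCommGroup E] [NormedSpace ℝ E]
    [CompleteSpace E] {h : ℝ → ℝ} {v : ℝ → E} (hh : Continuous h) (hv : Continuous v) :
    Tendsto (fun N : ℕ => ∑ i ∈ Finset.range N,
      (∫ u in (i / N : ℝ)..((i + 1 : ℕ) / N : ℝ), h u) • v (i / N)) atTop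
      (𝓝 (∫ u in (0 : ℝ)..1, h u • v u)) := by
  obtain ⟨C, hC⟩ := isCompact_Icc.exists_bound_of_continuousOn (s := Set.Icc (0 : ℝ) 1)
    hh.continuousOn
  have hC0 : 0 ≤ C := (norm_nonneg _).trans (hC 0 (by simp))
  have huc := isCompact_Icc.uniformContinuousOn_of_continuous (s := Set.Icc (0 : ℝ) 1)
    hv.continuousOn
  rw [Metric.tendsto_atTop]
  intro ε hε
  -- With `|h| ≤ C` this oscillation of `v` costs at most `ε / 2` times the cell length `1 / N`,
  -- hence `ε / 2` in total; `C + 1` only avoids division by zero.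
  obtain ⟨δ, hδ, huc⟩ := Metric.uniformContinuousOn_iff.1 huc (ε / (2 * (C + 1))) (by positivity)
  obtain ⟨N₀, hN₀⟩ := exists_nat_gt (1 / δ)
  refine ⟨N₀ + 1, fun N hN => ?_⟩
  have hN0 : (0 : ℝ) < N := by exact_mod_cast (by omega : 0 < N)
  have hNδ : 1 / (N : ℝ) < δ := by
    have : (N₀ : ℝ) ≤ N := by exact_mod_cast (by omega : N₀ ≤ N)
    rw [div_lt_iff₀ hN0]
    rw [div_lt_iff₀ hδ] at hN₀
    nlinarith
  have hsplit : ∫ u in (0 : ℝ)..1, h u • v u = ∑ i ∈ Finset.range N,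
      ∫ u in (i / N : ℝ)..((i + 1 : ℕ) / N : ℝ), h u • v u := by
    have := intervalIntegral.sum_integral_adjacent_intervals (f := fun u => h u • v u)
      (a := fun i : ℕ => (i / N : ℝ)) (n := N) (μ := volume)
      (fun k _ => (hh.smul hv).intervalIntegrable _ _)
    simp only [Nat.cast_zero, zero_div, div_self hN0.ne'] at this
    exact this.symm
  rw [dist_eq_norm, hsplit, ← Finset.sum_sub_distrib]
  have hterm : ∀ i ∈ Finset.range N,
      ‖(∫ u in (i / N : ℝ)..((i + 1 : ℕ) / N : ℝ), h u) • v (i / N) -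
        ∫ u in (i / N : ℝ)..((i + 1 : ℕ) / N : ℝ), h u • v u‖ ≤
      ε / 2 * (1 / N) := by
    intro i hi
    have hi' : (i + 1 : ℝ) ≤ N := by exact_mod_cast Finset.mem_range.1 hi
    have hi1 : Continuous fun u => h u • v (i / N) := by fun_prop
    have hi2 : Continuous fun u => h u • v u := by fun_prop
    rw [← intervalIntegral.integral_smul_const, ← intervalIntegral.integral_sub
      (hi1.intervalIntegrable _ _) (hi2.intervalIntegrable _ _)]
    have hlen : ((i + 1 : ℕ) / N : ℝ) - i / N = 1 / N := by push_cast; ring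
    have hle : (i / N : ℝ) ≤ ((i + 1 : ℕ) / N : ℝ) := by
      have : (0 : ℝ) < 1 / N := by positivity
      linarith
    have hb : ∀ u ∈ Set.uIoc (i / N : ℝ) ((i + 1 : ℕ) / N : ℝ),
        ‖h u • v (i / N) - h u • v u‖ ≤ ε / 2 := by
      intro u hu
      rw [Set.uIoc_of_le hle] at hu
      have h1 : ((i + 1 : ℕ) / N : ℝ) ≤ 1 := by
        rw [div_le_one hN0]; push_cast; exact hi'
      have h0 : (0 : ℝ) ≤ i / N := by positivity
      rw [← smul_sub, norm_smul]
      have h2 := (huc (i / N) ⟨h0, hle.trans h1⟩ u ⟨h0.trans hu.1.le, hu.2.trans h1⟩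
        (by rw [Real.dist_eq, abs_lt]; constructor <;> linarith [hu.1, hu.2])).le
      rw [dist_eq_norm] at h2
      have h3 := hC u ⟨h0.trans hu.1.le, hu.2.trans h1⟩
      calc ‖h u‖ * ‖v (i / N) - v u‖ ≤ C * (ε / (2 * (C + 1))) :=
            mul_le_mul h3 h2 (norm_nonneg _) hC0
        _ ≤ (C + 1) * (ε / (2 * (C + 1))) := by gcongr; linarith
        _ = ε / 2 := by field_simp
    refine (intervalIntegral.norm_integral_le_of_norm_le_const hb).trans_eq ?_
    rw [hlen, abs_of_nonneg (by positivity)]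
  refine (norm_sum_le_of_le _ hterm).trans_lt ?_
  rw [Finset.sum_const, Finset.card_range, nsmul_eq_mul]
  field_simp
  linarith

theorem tendsto_riemann_sum {E : Type*} [NormedAddCommGroup E] [NormedSpace ℝ E]
    [CompleteSpace E] {v : ℝ → E} (hv : Continuous v) (a b : ℝ) :
    Tendsto (fun N : ℕ => ∑ i ∈ Finset.range N, ((b - a) / N) • v (a + (b - a) * (i / N))) atTop
      (𝓝 (∫ u in a..b, v u)) := by
  have h := tendsto_sum_integral_smul (h := fun _ => b - a)
    (v := fun u => v (a + (b - a) * u)) continuous_const (by fun_prop)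
  have e : ∫ u in (0 : ℝ)..1, (b - a) • v (a + (b - a) * u) = ∫ u in a..b, v u := by
    rw [intervalIntegral.integral_smul, intervalIntegral.smul_integral_comp_add_mul]
    simp
  rw [e] at h
  refine h.congr fun N => Finset.sum_congr rfl fun i _ => ?_
  congr 1
  rw [intervalIntegral.integral_const, smul_eq_mul]
  push_cast
  ring

/-- A pathwise integral of a continuous version of `τ ↦ V (φ τ)` is `V (∫ φ)`. -/
theorem IsIsonormal.integral_ae {Ω H : Type*} [MeasurableSpace Ω] [NormedAddCommGroup H]
    [InnerProductSpace ℝ H] [CompleteSpace H] {P : Measure Ω} {V : H → Ω → ℝ}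
    (hV : IsIsonormal P V) {φ : ℝ → H} (hφ : Continuous φ) {Y : ℝ → Ω → ℝ}
    (hY : ∀ ω, Continuous fun τ => Y τ ω) (hYφ : ∀ τ, Y τ =ᵐ[P] V (φ τ)) (a b : ℝ) :
    (fun ω => ∫ τ in a..b, Y τ ω) =ᵐ[P] V (∫ τ in a..b, φ τ) := by
  refine hV.ae_eq_of_tendsto (tendsto_riemann_sum hφ a b) ?_
  have h1 : ∀ N : ℕ, V (∑ i ∈ Finset.range N, ((b - a) / N) • φ (a + (b - a) * (i / N))) =ᵐ[P]
      fun ω => ∑ i ∈ Finset.range N, ((b - a) / N) • Y (a + (b - a) * (i / N)) ω := by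
    intro N
    refine (hV.sum_ae _ _ _).trans ?_
    have h2 := ae_all_iff.2 fun i : ℕ => hYφ (a + (b - a) * (i / N))
    filter_upwards [h2] with ω hω
    exact Finset.sum_congr rfl fun i _ => by rw [hω i, smul_eq_mul]
  filter_upwards [ae_all_iff.2 h1] with ω hω
  simp_rw [hω]
  exact tendsto_riemann_sum (hY ω) a b

/-! ### Bilinear forms in independent isonormal processes -/

section Bilinear

variable {Ω H : Type*} [MeasurableSpace Ω] [NormedAddCommGroup H] [InnerProductSpace ℝ H]
  {P : Measure Ω} {V V₁ V₂ : H → Ω → ℝ}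

/-- Power mean inequality for the numbers `a i ^ 2`. Of the factor `(K / N) ^ m` it consumes `N ^ (m
- 1)`, and the remaining `1 / N` compensates a sum of `N` bounded terms. -/
theorem pow_two_mul_norm_le {N : ℕ} (hN : N ≠ 0) {K : ℝ} (hK0 : 0 ≤ K) {g : ℕ → H}
    (hK : ∀ a : ℕ → ℝ, ‖∑ i ∈ Finset.range N, a i • g i‖ ^ 2 ≤
      K / N * ∑ i ∈ Finset.range N, a i ^ 2) {m : ℕ} (hm : m ≠ 0) (a : ℕ → ℝ) :
    ‖∑ i ∈ Finset.range N, a i • g i‖ ^ (2 * m) ≤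
      K ^ m / N * ∑ i ∈ Finset.range N, |a i| ^ (2 * m) := by
  obtain ⟨m, rfl⟩ := Nat.exists_eq_succ_of_ne_zero hm
  have hN0 : (0 : ℝ) < N := by exact_mod_cast Nat.pos_of_ne_zero hN
  have h1 := pow_sum_div_card_le_sum_pow (s := Finset.range N) (f := fun i => a i ^ 2)
    (fun i _ => sq_nonneg _) m
  rw [Finset.card_range, div_le_iff₀ (by positivity)] at h1
  rw [pow_mul]
  calc (‖∑ i ∈ Finset.range N, a i • g i‖ ^ 2) ^ (m + 1)
      ≤ (K / N * ∑ i ∈ Finset.range N, a i ^ 2) ^ (m + 1) := by gcongr; exact hK a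
    _ = K ^ (m + 1) / N ^ (m + 1) * (∑ i ∈ Finset.range N, a i ^ 2) ^ (m + 1) := by
        rw [mul_pow, div_pow]
    _ ≤ K ^ (m + 1) / N ^ (m + 1) *
          ((∑ i ∈ Finset.range N, (a i ^ 2) ^ (m + 1)) * N ^ m) := by gcongr
    _ = K ^ (m + 1) / N * ∑ i ∈ Finset.range N, (a i ^ 2) ^ (m + 1) := by
        field_simp; ring
    _ = _ := by
        congr 1
        refine Finset.sum_congr rfl fun i _ => ?_
        rw [pow_mul, sq_abs]

/-- Conditionally on `V₁` the sum is a Gaussian variable of variance `‖∑ V₁ (v i) • g i‖ ^ 2`. Its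
moments are bounded through `hK`, and averaging over `V₁` leaves single Gaussian moments of the `V₁
(v i)`. The bound does not depend on the number of terms. -/
theorem eLpNorm_sum_mul_le [IsProbabilityMeasure P] (hV₁ : IsIsonormal P V₁) (hV₂ : IsIsonormal P V₂)
    (hind : IndepFun (fun ω f => V₁ f ω) (fun ω f => V₂ f ω) P) {N : ℕ} (hN : N ≠ 0)
    {K δ : ℝ} (hK0 : 0 ≤ K) (hδ : 0 ≤ δ) {v g : ℕ → H}
    (hK : ∀ a : ℕ → ℝ, ‖∑ i ∈ Finset.range N, a i • g i‖ ^ 2 ≤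
      K / N * ∑ i ∈ Finset.range N, a i ^ 2)
    (hv : ∀ i < N, ‖v i‖ ≤ δ) {m : ℕ} (hm : m ≠ 0) :
    eLpNorm (fun ω => ∑ i ∈ Finset.range N, V₁ (v i) ω * V₂ (g i) ω) (2 * m : ℕ) P ≤
      gaussianNorm (2 * m : ℕ) ^ 2 * ENNReal.ofReal (√K * δ) := by
  set q : ℕ := 2 * m with hq
  have hq0 : q ≠ 0 := by omega
  set G := gaussianNorm q with hG
  have hN0 : (0 : ℝ) < N := by exact_mod_cast Nat.pos_of_ne_zero hN
  have hAm : AEMeasurable (fun ω (i : ℕ) => V₁ (v i) ω) P :=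
    aemeasurable_pi_lambda _ fun i => hV₁.aemeasurable _
  have hBm : AEMeasurable (fun ω (i : ℕ) => V₂ (g i) ω) P :=
    aemeasurable_pi_lambda _ fun i => hV₂.aemeasurable _
  have hAB : IndepFun (fun ω (i : ℕ) => V₁ (v i) ω) (fun ω (i : ℕ) => V₂ (g i) ω) P :=
    hind.comp (φ := fun x (i : ℕ) => x (v i)) (ψ := fun x (i : ℕ) => x (g i))
      (measurable_pi_lambda _ fun i => measurable_pi_apply _)
      (measurable_pi_lambda _ fun i => measurable_pi_apply _)
  have hmeas : Measurable fun z : (ℕ → ℝ) × (ℕ → ℝ) =>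
      ‖∑ i ∈ Finset.range N, z.1 i * z.2 i‖ₑ ^ q := by fun_prop
  have hinner : ∀ a : ℕ → ℝ,
      ∫⁻ ω, ‖∑ i ∈ Finset.range N, a i * V₂ (g i) ω‖ₑ ^ q ∂P ≤
        G ^ q * ENNReal.ofReal (K ^ m / N) * ∑ i ∈ Finset.range N, ‖a i‖ₑ ^ q := by
    intro a
    have h1 : ∫⁻ ω, ‖∑ i ∈ Finset.range N, a i * V₂ (g i) ω‖ₑ ^ q ∂P =
        ∫⁻ ω, ‖V₂ (∑ i ∈ Finset.range N, a i • g i) ω‖ₑ ^ q ∂P := by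
      refine lintegral_congr_ae ?_
      filter_upwards [hV₂.sum_ae (Finset.range N) a g] with ω hω
      rw [hω]
    rw [h1, hV₂.lintegral_enorm_pow _ hq0, mul_pow, mul_comm, mul_assoc]
    gcongr
    have h2 := pow_two_mul_norm_le hN hK0 hK hm a
    rw [← ofReal_norm, ← ENNReal.ofReal_pow (norm_nonneg _)]
    refine (ENNReal.ofReal_le_ofReal h2).trans_eq ?_
    rw [ENNReal.ofReal_mul (by positivity), ENNReal.ofReal_sum_of_nonneg fun i _ => by positivity]
    congr 1
    refine Finset.sum_congr rfl fun i _ => ?_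
    rw [ENNReal.ofReal_pow (abs_nonneg _), ← Real.norm_eq_abs, ofReal_norm]
  have hmain : ∫⁻ ω, ‖∑ i ∈ Finset.range N, V₁ (v i) ω * V₂ (g i) ω‖ₑ ^ q ∂P ≤
      (G ^ 2 * ENNReal.ofReal (√K * δ)) ^ q := by
    have h1 : ∫⁻ ω, ‖∑ i ∈ Finset.range N, V₁ (v i) ω * V₂ (g i) ω‖ₑ ^ q ∂P =
        ∫⁻ z, ‖∑ i ∈ Finset.range N, z.1 i * z.2 i‖ₑ ^ q
          ∂(P.map fun ω => ((fun i : ℕ => V₁ (v i) ω), (fun i : ℕ => V₂ (g i) ω))) := by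
      rw [lintegral_map' hmeas.aemeasurable (hAm.prodMk hBm)]
    -- Independence makes the joint law a product, so Fubini permits freezing the `V₁` coordinates
    -- and applying `hinner`.
    rw [h1, (indepFun_iff_map_prod_eq_prod_map_map hAm hBm).1 hAB,
      lintegral_prod _ hmeas.aemeasurable]
    have h2 : ∀ a : ℕ → ℝ, ∫⁻ y, ‖∑ i ∈ Finset.range N, a i * y i‖ₑ ^ q
        ∂(P.map fun ω (i : ℕ) => V₂ (g i) ω) =
        ∫⁻ ω, ‖∑ i ∈ Finset.range N, a i * V₂ (g i) ω‖ₑ ^ q ∂P := fun a => by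
      rw [lintegral_map' (f := fun y : ℕ → ℝ => ‖∑ i ∈ Finset.range N, a i * y i‖ₑ ^ q)
        (hmeas.comp (measurable_const.prodMk measurable_id)).aemeasurable hBm]
    simp only [h2]
    refine (lintegral_mono hinner).trans ?_
    have hmeas' : Measurable fun a : ℕ → ℝ =>
        G ^ q * ENNReal.ofReal (K ^ m / N) * ∑ i ∈ Finset.range N, ‖a i‖ₑ ^ q := by
      refine Measurable.const_mul ?_ _
      fun_prop
    rw [lintegral_map' hmeas'.aemeasurable hAm, lintegral_const_mul'' _
      (Finset.aemeasurable_fun_sum _ fun i _ => (hV₁.aemeasurable (v i)).enorm.pow_const q),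
      lintegral_finsetSum' _ fun i _ => (hV₁.aemeasurable (v i)).enorm.pow_const q]
    have h3 : ∑ i ∈ Finset.range N, ∫⁻ ω, ‖V₁ (v i) ω‖ₑ ^ q ∂P ≤
        ENNReal.ofReal (N * δ ^ q) * G ^ q := by
      calc ∑ i ∈ Finset.range N, ∫⁻ ω, ‖V₁ (v i) ω‖ₑ ^ q ∂P
          ≤ ∑ i ∈ Finset.range N, (ENNReal.ofReal δ * G) ^ q := by
            refine Finset.sum_le_sum fun i hi => ?_
            rw [hV₁.lintegral_enorm_pow _ hq0, ← ofReal_norm]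
            gcongr
            exact hv i (Finset.mem_range.1 hi)
        _ = _ := by
            rw [Finset.sum_const, Finset.card_range, nsmul_eq_mul, mul_pow,
              ENNReal.ofReal_mul (by positivity), ENNReal.ofReal_natCast,
              ENNReal.ofReal_pow hδ, mul_assoc]
    calc G ^ q * ENNReal.ofReal (K ^ m / N) *
          ∑ i ∈ Finset.range N, ∫⁻ ω, ‖V₁ (v i) ω‖ₑ ^ q ∂P
        ≤ G ^ q * ENNReal.ofReal (K ^ m / N) * (ENNReal.ofReal (N * δ ^ q) * G ^ q) := by gcongr
      _ = G ^ q * G ^ q * (ENNReal.ofReal (K ^ m / N) * ENNReal.ofReal (N * δ ^ q)) := by ring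
      _ = (G ^ 2 * ENNReal.ofReal (√K * δ)) ^ q := by
        rw [← ENNReal.ofReal_mul (by positivity), mul_pow,
          ← ENNReal.ofReal_pow (by positivity), ← pow_mul, mul_comm 2 q, ← pow_add, ← mul_two]
        congr 2
        rw [mul_pow, hq, pow_mul (√K), Real.sq_sqrt hK0]
        field_simp
  have h := eLpNorm_nnreal_pow_eq_lintegral (μ := P)
    (f := fun ω => ∑ i ∈ Finset.range N, V₁ (v i) ω * V₂ (g i) ω) (p := q) (by simpa using hq0)
  simp only [NNReal.coe_natCast, ENNReal.rpow_natCast] at h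
  rw [← h] at hmain
  exact (ENNReal.pow_le_pow_left_iff hq0).1 hmain

/-- `L^p` distance between products of values of isonormal processes. -/
theorem eLpNorm_mul_sub_mul_le (hV₁ : IsIsonormal P V₁) (hV₂ : IsIsonormal P V₂)
    (a a' b b' : H) {p : ℝ≥0∞} (hp : 1 ≤ p) :
    eLpNorm (fun ω => V₁ a ω * V₂ b ω - V₁ a' ω * V₂ b' ω) p P ≤
      gaussianNorm (2 * p) ^ 2 * (‖a - a'‖ₑ * ‖b‖ₑ + ‖a'‖ₑ * ‖b - b'‖ₑ) := by
  have : ENNReal.HolderTriple (2 * p) (2 * p) p := ⟨by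
    rw [← two_mul, ENNReal.mul_inv (by simp) (by simp), ← mul_assoc,
      ENNReal.mul_inv_cancel (by simp) (by simp), one_mul]⟩
  have hmul : ∀ f g : Ω → ℝ, AEStronglyMeasurable f P → AEStronglyMeasurable g P →
      eLpNorm (fun ω => f ω * g ω) p P ≤ eLpNorm f (2 * p) P * eLpNorm g (2 * p) P := by
    intro f g hf hg
    have h := eLpNorm_smul_le_mul_eLpNorm (p := 2 * p) (q := 2 * p) (r := p) hg hf
    exact h
  have h1 : (fun ω => V₁ a ω * V₂ b ω - V₁ a' ω * V₂ b' ω) =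
      (fun ω => (V₁ a ω - V₁ a' ω) * V₂ b ω) + fun ω => V₁ a' ω * (V₂ b ω - V₂ b' ω) := by
    ext ω; simp only [Pi.add_apply]; ring
  have m1 := hV₁.aestronglyMeasurable
  have m2 := hV₂.aestronglyMeasurable
  have s1 : AEStronglyMeasurable (fun ω => V₁ a ω - V₁ a' ω) P := (m1 a).sub (m1 a')
  have s2 : AEStronglyMeasurable (fun ω => V₂ b ω - V₂ b' ω) P := (m2 b).sub (m2 b')
  rw [h1]
  refine (eLpNorm_add_le (s1.mul (m2 b)) ((m1 a').mul s2) hp).trans ?_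
  refine (add_le_add (hmul _ _ s1 (m2 b)) (hmul _ _ (m1 a') s2)).trans_eq ?_
  rw [hV₁.eLpNorm_sub, hV₂.eLpNorm_sub, hV₁.eLpNorm_eq, hV₂.eLpNorm_eq]
  ring

end Bilinear

/-! ### Refining Riemann-Stieltjes sums -/

theorem sum_range_mul_eq {E : Type*} [AddCommMonoid E] (φ : ℕ → E) (N M : ℕ) :
    ∑ k ∈ Finset.range (N * M), φ k =
      ∑ i ∈ Finset.range N, ∑ j ∈ Finset.range M, φ (i * M + j) := by
  induction N with
  | zero => simp
  | succ N ih => rw [Nat.succ_mul, Finset.sum_range_add, ih, Finset.sum_range_succ]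

/-- The natural number quotient `k / M` is the index of the coarse cell containing the fine point
`k`. On one coarse cell the coarse value of `x` is constant, so the fine increments of `y` telescope
to the coarse increment. -/
theorem sum_refine {N M : ℕ} (hN : N ≠ 0) (hM : M ≠ 0) (x y : ℝ → ℝ) :
    ∑ k ∈ Finset.range (N * M), (x (k / (N * M : ℕ)) - x ((k / M : ℕ) / N)) *
        (y ((k + 1 : ℕ) / (N * M : ℕ)) - y (k / (N * M : ℕ))) =
      ∑ k ∈ Finset.range (N * M), x (k / (N * M : ℕ)) *
          (y ((k + 1 : ℕ) / (N * M : ℕ)) - y (k / (N * M : ℕ))) -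
        ∑ i ∈ Finset.range N, x (i / N) * (y ((i + 1 : ℕ) / N) - y (i / N)) := by
  simp only [sub_mul, Finset.sum_sub_distrib]
  congr 1
  rw [sum_range_mul_eq]
  refine Finset.sum_congr rfl fun i _ => ?_
  have hN0 : (N : ℝ) ≠ 0 := by exact_mod_cast hN
  have hM0 : (M : ℝ) ≠ 0 := by exact_mod_cast hM
  have h1 : ∀ j ∈ Finset.range M, x (((i * M + j) / M : ℕ) / N) *
      (y ((i * M + j + 1 : ℕ) / (N * M : ℕ)) - y ((i * M + j : ℕ) / (N * M : ℕ))) =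
      x (i / N) * ((fun j : ℕ => y ((i * M + j : ℕ) / (N * M : ℕ))) (j + 1) -
        (fun j : ℕ => y ((i * M + j : ℕ) / (N * M : ℕ))) j) := by
    intro j hj
    have : (i * M + j) / M = i := by
      rw [mul_comm, Nat.mul_add_div (Nat.pos_of_ne_zero hM),
        Nat.div_eq_of_lt (Finset.mem_range.1 hj), add_zero]
    rw [this]
    rfl
  rw [Finset.sum_congr rfl h1, ← Finset.mul_sum,
    Finset.sum_range_sub (fun j : ℕ => y ((i * M + j : ℕ) / (N * M : ℕ)))]
  have e1 : ((i * M + M : ℕ) / (N * M : ℕ) : ℝ) = (i + 1 : ℕ) / N := by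
    push_cast; field_simp
  have e2 : ((i * M + 0 : ℕ) / (N * M : ℕ) : ℝ) = i / N := by
    push_cast; field_simp; ring
  simp only [e1, e2]

/-! ### Iterated integrals of continuous versions -/

/-- `h` is a version with continuous paths of the process `τ ↦ V (f τ)`. -/
structure IsContinuousVersion {Ω H : Type*} [MeasurableSpace Ω] [NormedAddCommGroup H]
    (P : Measure Ω) (V : H → Ω → ℝ) (f : ℝ → H) (h : ℝ → Ω → ℝ) : Prop where
  continuous_index : Continuous f
  continuous_path : ∀ ω, Continuous fun τ => h τ ω
  ae_eq : ∀ τ, h τ =ᵐ[P] V (f τ)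

/-- The iterated integral `∫_0^1 (∫_0^u h₁) h₂(u) du`. -/
noncomputable def iterated (h₁ h₂ : ℝ → ℝ) : ℝ :=
  ∫ u in (0 : ℝ)..1, (∫ τ in (0 : ℝ)..u, h₁ τ) * h₂ u

/-- The Riemann-Stieltjes sum for `iterated h₁ h₂` with `N` equal steps. -/
noncomputable def iteratedSum (N : ℕ) (h₁ h₂ : ℝ → ℝ) : ℝ :=
  ∑ i ∈ Finset.range N, (∫ τ in (0 : ℝ)..(i / N), h₁ τ) *
    ((∫ τ in (0 : ℝ)..((i + 1 : ℕ) / N), h₂ τ) - ∫ τ in (0 : ℝ)..(i / N), h₂ τ)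

theorem iteratedSum_one (h₁ h₂ : ℝ → ℝ) : iteratedSum 1 h₁ h₂ = 0 := by
  simp [iteratedSum]

theorem continuous_primitive {E : Type*} [NormedAddCommGroup E] [NormedSpace ℝ E]
    {h : ℝ → E} (hh : Continuous h) : Continuous fun u => ∫ τ in (0 : ℝ)..u, h τ :=
  intervalIntegral.continuous_primitive (fun _ _ => hh.intervalIntegrable _ _) 0

theorem tendsto_iteratedSum {h₁ h₂ : ℝ → ℝ} (hh₁ : Continuous h₁) (hh₂ : Continuous h₂) :
    Tendsto (fun N => iteratedSum N h₁ h₂) atTop (𝓝 (iterated h₁ h₂)) := by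
  have h := tendsto_sum_integral_smul hh₂ (continuous_primitive hh₁)
  simp only [smul_eq_mul] at h
  have e : ∫ u in (0 : ℝ)..1, h₂ u * ∫ τ in (0 : ℝ)..u, h₁ τ = iterated h₁ h₂ := by
    simp only [iterated, mul_comm]
  rw [e] at h
  refine h.congr fun N => Finset.sum_congr rfl fun i _ => ?_
  rw [mul_comm, intervalIntegral.integral_interval_sub_left (hh₂.intervalIntegrable _ _)
    (hh₂.intervalIntegrable _ _)]

/-- The integrand is the derivative of half the squared primitive. Diagonal coefficients thus need
no independence. -/
theorem iterated_self {h : ℝ → ℝ} (hh : Continuous h) :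
    iterated h h = (∫ τ in (0 : ℝ)..1, h τ) * (∫ τ in (0 : ℝ)..1, h τ) / 2 := by
  have hd : ∀ u, HasDerivAt (fun u => (∫ τ in (0 : ℝ)..u, h τ) ^ 2 / 2)
      ((∫ τ in (0 : ℝ)..u, h τ) * h u) u := by
    intro u
    have h1 : HasDerivAt (fun u => ∫ τ in (0 : ℝ)..u, h τ) (h u) u :=
      intervalIntegral.integral_hasDerivAt_right (hh.intervalIntegrable _ _)
        hh.aestronglyMeasurable.stronglyMeasurableAtFilter hh.continuousAt
    have h2 := (h1.pow 2).div_const 2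
    refine h2.congr_deriv ?_
    simp
    ring
  have hc : Continuous fun u => (∫ τ in (0 : ℝ)..u, h τ) * h u := (continuous_primitive hh).mul hh
  rw [iterated, intervalIntegral.integral_eq_sub_of_hasDerivAt (fun u _ => hd u)
    (hc.intervalIntegrable _ _)]
  simp [sq]

/-! ### Uniform approximation by Riemann-Stieltjes sums and convergence of iterated integrals -/

section

variable {Ω H : Type*} [MeasurableSpace Ω] [NormedAddCommGroup H] [InnerProductSpace ℝ H]
  [CompleteSpace H] {P : Measure Ω} {V V₁ V₂ : H → Ω → ℝ}

/-- Almost orthogonality of the increments of the primitive of `f` on `[0, 1]`. -/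
def StepBound (f : ℝ → H) (K : ℝ) : Prop :=
  ∀ N : ℕ, N ≠ 0 → ∀ a : ℕ → ℝ,
    ‖∑ i ∈ Finset.range N, a i • ∫ u in ((i : ℝ) / N)..((i + 1 : ℕ) / N), f u‖ ^ 2 ≤
      K / N * ∑ i ∈ Finset.range N, a i ^ 2

omit [CompleteSpace H] in
-- The difference is the integral of `f` over at most `M` consecutive cells of the partition into `N
-- * M` cells. Testing the step bound with the indicator of these cells gives `K / (N * M) * M`.
theorem StepBound.norm_sub_le {f : ℝ → H} {K : ℝ} (hK : StepBound f K) (hf : Continuous f)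
    (hK0 : 0 ≤ K) {N M k : ℕ} (hN : N ≠ 0)
    (hM : M ≠ 0) (hk : k < N * M) :
    ‖(∫ u in (0 : ℝ)..(k / (N * M : ℕ)), f u) - ∫ u in (0 : ℝ)..((k / M : ℕ) / N), f u‖ ≤
      √(K / N) := by
  have hN0 : (N : ℝ) ≠ 0 := by exact_mod_cast hN
  have hM0 : (M : ℝ) ≠ 0 := by exact_mod_cast hM
  have hle : k / M * M ≤ k := Nat.div_mul_le_self k M
  have h := hK (N * M) (mul_ne_zero hN hM)
    (fun i => if i ∈ Finset.Ico (k / M * M) k then 1 else 0)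
  have hsub : (Finset.range (N * M)).filter (· ∈ Finset.Ico (k / M * M) k) =
      Finset.Ico (k / M * M) k := by
    ext i; simp only [Finset.mem_filter, Finset.mem_range, Finset.mem_Ico]; omega
  simp only [ite_smul, one_smul, zero_smul, ite_pow, one_pow, ne_eq, OfNat.ofNat_ne_zero,
    not_false_eq_true, zero_pow] at h
  rw [← Finset.sum_filter, ← Finset.sum_filter, hsub,
    intervalIntegral.sum_integral_adjacent_intervals_Ico
      (a := fun i : ℕ => (i : ℝ) / (N * M : ℕ)) hle
      (fun _ _ => hf.intervalIntegrable _ _)] at h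
  have e : ((k / M * M : ℕ) : ℝ) / (N * M : ℕ) = (k / M : ℕ) / N := by
    push_cast; field_simp
  rw [intervalIntegral.integral_interval_sub_left (hf.intervalIntegrable _ _)
    (hf.intervalIntegrable _ _)]
  rw [e] at h
  refine Real.le_sqrt_of_sq_le (h.trans ?_)
  have hcard : ((k - k / M * M : ℕ) : ℝ) ≤ M := by
    have h1 := Nat.mod_lt k (Nat.pos_of_ne_zero hM)
    have h2 := Nat.div_add_mod' k M
    exact_mod_cast (by omega : k - k / M * M ≤ M)
  simp only [Finset.sum_const, Nat.card_Ico, nsmul_eq_mul, mul_one]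
  calc K / (N * M : ℕ) * ((k - k / M * M : ℕ) : ℝ) ≤ K / (N * M : ℕ) * M := by gcongr
    _ = K / N := by push_cast; field_simp

theorem IsContinuousVersion.primitive_ae (hV : IsIsonormal P V) {f : ℝ → H} {h : ℝ → Ω → ℝ}
    (hf : IsContinuousVersion P V f h) (u : ℝ) :
    (fun ω => ∫ τ in (0 : ℝ)..u, h τ ω) =ᵐ[P] V (∫ τ in (0 : ℝ)..u, f τ) :=
  hV.integral_ae hf.continuous_index hf.continuous_path hf.ae_eq 0 u

theorem aestronglyMeasurable_iteratedSum (hV₁ : IsIsonormal P V₁) (hV₂ : IsIsonormal P V₂)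
    {f : ℝ → H} {h₁ h₂ : ℝ → Ω → ℝ} (hf₁ : IsContinuousVersion P V₁ f h₁)
    (hf₂ : IsContinuousVersion P V₂ f h₂) (N : ℕ) :
    AEStronglyMeasurable (fun ω => iteratedSum N (h₁ · ω) (h₂ · ω)) P := by
  have m1 : ∀ u, AEStronglyMeasurable (fun ω => ∫ τ in (0 : ℝ)..u, h₁ τ ω) P := fun u =>
    (hV₁.aestronglyMeasurable _).congr (hf₁.primitive_ae hV₁ u).symm
  have m2 : ∀ u, AEStronglyMeasurable (fun ω => ∫ τ in (0 : ℝ)..u, h₂ τ ω) P := fun u =>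
    (hV₂.aestronglyMeasurable _).congr (hf₂.primitive_ae hV₂ u).symm
  unfold iteratedSum
  exact Finset.aestronglyMeasurable_fun_sum _ fun i _ => (m1 _).mul ((m2 _).sub (m2 _))

theorem aestronglyMeasurable_iterated (hV₁ : IsIsonormal P V₁) (hV₂ : IsIsonormal P V₂)
    {f : ℝ → H} {h₁ h₂ : ℝ → Ω → ℝ} (hf₁ : IsContinuousVersion P V₁ f h₁)
    (hf₂ : IsContinuousVersion P V₂ f h₂) :
    AEStronglyMeasurable (fun ω => iterated (h₁ · ω) (h₂ · ω)) P :=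
  aestronglyMeasurable_of_tendsto_ae atTop
    (fun N => aestronglyMeasurable_iteratedSum hV₁ hV₂ hf₁ hf₂ N)
    (Eventually.of_forall fun ω =>
      tendsto_iteratedSum (hf₁.continuous_path ω) (hf₂.continuous_path ω))

/-- Refining the partition, the fine sum minus the coarse sum is a bilinear form of independent
Gaussians, with first factors of norm at most `√(K / N)`. The bound sees `f` only through `K`, which
makes it uniform along a family of curves. -/
theorem eLpNorm_iterated_sub_iteratedSum_le [IsProbabilityMeasure P]
    (hV₁ : IsIsonormal P V₁) (hV₂ : IsIsonormal P V₂)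
    (hind : IndepFun (fun ω f => V₁ f ω) (fun ω f => V₂ f ω) P)
    {f : ℝ → H} {h₁ h₂ : ℝ → Ω → ℝ} (hf₁ : IsContinuousVersion P V₁ f h₁)
    (hf₂ : IsContinuousVersion P V₂ f h₂) {K : ℝ} (hK0 : 0 ≤ K) (hK : StepBound f K)
    {N : ℕ} (hN : N ≠ 0) {m : ℕ} (hm : m ≠ 0) :
    eLpNorm (fun ω => iterated (h₁ · ω) (h₂ · ω) - iteratedSum N (h₁ · ω) (h₂ · ω))
      (2 * m : ℕ) P ≤ gaussianNorm (2 * m : ℕ) ^ 2 * ENNReal.ofReal (√K * √(K / N)) := by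
  have hmeas := aestronglyMeasurable_iteratedSum hV₁ hV₂ hf₁ hf₂
  have hlim : ∀ ω, Tendsto (fun M : ℕ => iteratedSum (N * (M + 1)) (h₁ · ω) (h₂ · ω) -
      iteratedSum N (h₁ · ω) (h₂ · ω)) atTop
      (𝓝 (iterated (h₁ · ω) (h₂ · ω) - iteratedSum N (h₁ · ω) (h₂ · ω))) := by
    intro ω
    refine Tendsto.sub_const ?_ _
    refine (tendsto_iteratedSum (hf₁.continuous_path ω) (hf₂.continuous_path ω)).comp ?_
    exact tendsto_atTop_mono (fun M =>
      M.le_succ.trans (Nat.le_mul_of_pos_left _ (Nat.pos_of_ne_zero hN))) tendsto_id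
  -- Fatou's lemma: the sums with `N * (M + 1)` steps converge pathwise, so it suffices to bound
  -- their distance to the sum with `N` steps uniformly in `M`.
  refine (Lp.eLpNorm_lim_le_liminf_eLpNorm (fun M => (hmeas (N * (M + 1))).sub (hmeas N)) _
    (Eventually.of_forall hlim)).trans ?_
  refine (liminf_le_liminf (v := fun _ => gaussianNorm (2 * m : ℕ) ^ 2 *
    ENNReal.ofReal (√K * √(K / N))) (Eventually.of_forall fun M => ?_)).trans_eq (liminf_const _)
  set F : ℝ → H := fun u => ∫ τ in (0 : ℝ)..u, f τ with hF
  set L := N * (M + 1) with hL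
  have hL0 : L ≠ 0 := mul_ne_zero hN M.succ_ne_zero
  have hae : (fun ω => iteratedSum L (h₁ · ω) (h₂ · ω) - iteratedSum N (h₁ · ω) (h₂ · ω)) =ᵐ[P]
      fun ω => ∑ k ∈ Finset.range L, V₁ (F (k / L) - F ((k / (M + 1) : ℕ) / N)) ω *
        V₂ (F ((k + 1 : ℕ) / L) - F (k / L)) ω := by
    have a1 := ae_all_iff.2 fun k : ℕ => hf₁.primitive_ae hV₁ (k / L : ℝ)
    have a2 := ae_all_iff.2 fun k : ℕ => hf₁.primitive_ae hV₁ ((k / (M + 1) : ℕ) / N : ℝ)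
    have a3 := ae_all_iff.2 fun k : ℕ => hf₂.primitive_ae hV₂ (k / L : ℝ)
    have a4 := ae_all_iff.2 fun k : ℕ => hV₁.sub_ae (F (k / L)) (F ((k / (M + 1) : ℕ) / N))
    have a5 := ae_all_iff.2 fun k : ℕ => hV₂.sub_ae (F ((k + 1 : ℕ) / L)) (F (k / L))
    filter_upwards [a1, a2, a3, a4, a5] with ω b1 b2 b3 b4 b5
    have := sum_refine hN M.succ_ne_zero (fun u => ∫ τ in (0 : ℝ)..u, h₁ τ ω)
      (fun u => ∫ τ in (0 : ℝ)..u, h₂ τ ω)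
    unfold iteratedSum
    rw [Nat.succ_eq_add_one, ← hL] at this
    rw [← this]
    refine Finset.sum_congr rfl fun k _ => ?_
    rw [b4, b5, b1, b2, b3, b3]
  have hcongr := eLpNorm_congr_ae (p := (2 * m : ℕ)) hae
  refine hcongr.trans_le ?_
  refine eLpNorm_sum_mul_le hV₁ hV₂ hind hL0 hK0 (Real.sqrt_nonneg _) (fun a => ?_)
    (fun k hk => ?_) hm
  · refine le_trans (le_of_eq ?_) (hK L hL0 a)
    congr 2
    refine Finset.sum_congr rfl fun k _ => ?_
    rw [hF, intervalIntegral.integral_interval_sub_left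
      (hf₁.continuous_index.intervalIntegrable _ _) (hf₁.continuous_index.intervalIntegrable _ _)]
  · exact hK.norm_sub_le hf₁.continuous_index hK0 hN M.succ_ne_zero hk

theorem memLp_iterated [IsProbabilityMeasure P]
    (hV₁ : IsIsonormal P V₁) (hV₂ : IsIsonormal P V₂)
    (hind : IndepFun (fun ω f => V₁ f ω) (fun ω f => V₂ f ω) P)
    {f : ℝ → H} {h₁ h₂ : ℝ → Ω → ℝ} (hf₁ : IsContinuousVersion P V₁ f h₁)
    (hf₂ : IsContinuousVersion P V₂ f h₂) {K : ℝ} (hK0 : 0 ≤ K) (hK : StepBound f K)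
    {m : ℕ} (hm : m ≠ 0) :
    MemLp (fun ω => iterated (h₁ · ω) (h₂ · ω)) (2 * m : ℕ) P := by
  refine ⟨aestronglyMeasurable_iterated hV₁ hV₂ hf₁ hf₂, ?_⟩
  -- The sum with one step vanishes, since its only left endpoint is `0`; the error bound is then a
  -- moment bound.
  have h := eLpNorm_iterated_sub_iteratedSum_le hV₁ hV₂ hind hf₁ hf₂ hK0 hK one_ne_zero hm
  simp only [iteratedSum_one, sub_zero] at h
  exact h.trans_lt (ENNReal.mul_lt_top
    (ENNReal.pow_lt_top (gaussianNorm_ne_top (ENNReal.natCast_ne_top _)).lt_top)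
    ENNReal.ofReal_lt_top)

omit [CompleteSpace H] in
theorem tendsto_eLpNorm_mul_sub_mul (hV₁ : IsIsonormal P V₁) (hV₂ : IsIsonormal P V₂)
    {α : Type*} {l : Filter α} {a b : α → H} {a₀ b₀ : H} (ha : Tendsto a l (𝓝 a₀))
    (hb : Tendsto b l (𝓝 b₀)) {p : ℝ≥0∞} (hp : 1 ≤ p) (hp' : p ≠ ∞) :
    Tendsto (fun q : α × α => eLpNorm (fun ω => V₁ (a q.2) ω * V₂ (b q.2) ω -
      V₁ (a q.1) ω * V₂ (b q.1) ω) p P) (l ×ˢ l) (𝓝 0) := by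
  have hle : ∀ q : α × α, eLpNorm (fun ω => V₁ (a q.2) ω * V₂ (b q.2) ω -
      V₁ (a q.1) ω * V₂ (b q.1) ω) p P ≤ gaussianNorm (2 * p) ^ 2 *
        ENNReal.ofReal (‖a q.2 - a q.1‖ * ‖b q.2‖ + ‖a q.1‖ * ‖b q.2 - b q.1‖) := by
    intro q
    refine (eLpNorm_mul_sub_mul_le hV₁ hV₂ _ _ _ _ hp).trans_eq ?_
    rw [ENNReal.ofReal_add (by positivity) (by positivity), ENNReal.ofReal_mul (norm_nonneg _),
      ENNReal.ofReal_mul (norm_nonneg _)]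
    simp only [ofReal_norm]
  refine tendsto_of_tendsto_of_tendsto_of_le_of_le tendsto_const_nhds ?_
    (fun _ => zero_le) hle
  have hfst : Tendsto (Prod.fst : α × α → α) (l ×ˢ l) l := tendsto_fst
  have hsnd : Tendsto (Prod.snd : α × α → α) (l ×ˢ l) l := tendsto_snd
  have h1 : Tendsto (fun q : α × α => ‖a q.2 - a q.1‖ * ‖b q.2‖ + ‖a q.1‖ * ‖b q.2 - b q.1‖)
      (l ×ˢ l) (𝓝 (‖a₀ - a₀‖ * ‖b₀‖ + ‖a₀‖ * ‖b₀ - b₀‖)) :=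
    ((((ha.comp hsnd).sub (ha.comp hfst)).norm).mul (hb.comp hsnd).norm).add
      ((ha.comp hfst).norm.mul ((hb.comp hsnd).sub (hb.comp hfst)).norm)
  have h2 := ENNReal.Tendsto.const_mul (a := gaussianNorm (2 * p) ^ 2)
    ((ENNReal.continuous_ofReal.tendsto _).comp h1) (Or.inr (ENNReal.pow_ne_top
      (gaussianNorm_ne_top (ENNReal.mul_ne_top (by simp) hp'))))
  simpa [Function.comp_def] using h2

/-- Three-epsilon argument: `N` is fixed so that both approximation errors are small whatever the
indices, and then the sums with `N` steps are Cauchy because they depend on finitely many convergent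
vectors. -/
theorem tendsto_eLpNorm_iterated_sub [IsProbabilityMeasure P]
    (hV₁ : IsIsonormal P V₁) (hV₂ : IsIsonormal P V₂)
    (hind : IndepFun (fun ω f => V₁ f ω) (fun ω f => V₂ f ω) P)
    {f : ℤ → ℝ → H} {h₁ h₂ : ℤ → ℝ → Ω → ℝ} (hf₁ : ∀ j, IsContinuousVersion P V₁ (f j) (h₁ j))
    (hf₂ : ∀ j, IsContinuousVersion P V₂ (f j) (h₂ j)) {K : ℝ} (hK0 : 0 ≤ K)
    (hK : ∀ j, 0 ≤ j → StepBound (f j) K) {F : ℝ → H}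
    (hF : ∀ u ∈ Set.Icc (0 : ℝ) 1, Tendsto (fun j => ∫ τ in (0 : ℝ)..u, f j τ) atTop (𝓝 (F u)))
    {m : ℕ} (hm : m ≠ 0) :
    Tendsto (fun q : ℤ × ℤ => eLpNorm (fun ω => iterated (h₁ q.2 · ω) (h₂ q.2 · ω) -
      iterated (h₁ q.1 · ω) (h₂ q.1 · ω)) (2 * m : ℕ) P) (atTop ×ˢ atTop) (𝓝 0) := by
  have hp1 : (1 : ℝ≥0∞) ≤ (2 * m : ℕ) := by exact_mod_cast (by omega : 1 ≤ 2 * m)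
  set G := gaussianNorm (2 * m : ℕ) ^ 2 with hG
  have hGtop : G ≠ ∞ := ENNReal.pow_ne_top (gaussianNorm_ne_top (ENNReal.natCast_ne_top _))
  have hsum : ∀ N : ℕ, Tendsto (fun q : ℤ × ℤ => eLpNorm (fun ω =>
      iteratedSum N (h₁ q.2 · ω) (h₂ q.2 · ω) - iteratedSum N (h₁ q.1 · ω) (h₂ q.1 · ω))
      (2 * m : ℕ) P) (atTop ×ˢ atTop) (𝓝 0) := by
    intro N
    set A : ℕ → ℤ → H := fun i j => ∫ τ in (0 : ℝ)..(i / N), f j τ with hA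
    have hlim : ∀ i, i ≤ N → Tendsto (A i) atTop (𝓝 (F (i / N))) := by
      intro i hi
      refine hF _ ⟨by positivity, ?_⟩
      exact div_le_one_of_le₀ (by exact_mod_cast hi) (by positivity)
    have hae : ∀ j : ℤ, (fun ω => iteratedSum N (h₁ j · ω) (h₂ j · ω)) =ᵐ[P]
        fun ω => ∑ i ∈ Finset.range N, V₁ (A i j) ω * V₂ (A (i + 1) j - A i j) ω := by
      intro j
      have a1 := ae_all_iff.2 fun i : ℕ => (hf₁ j).primitive_ae hV₁ (i / N : ℝ)
      have a2 := ae_all_iff.2 fun i : ℕ => (hf₂ j).primitive_ae hV₂ (i / N : ℝ)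
      have a3 := ae_all_iff.2 fun i : ℕ => hV₂.sub_ae (A (i + 1) j) (A i j)
      filter_upwards [a1, a2, a3] with ω b1 b2 b3
      unfold iteratedSum
      refine Finset.sum_congr rfl fun i _ => ?_
      rw [b3, b1, b2, b2]
    have hle : ∀ q : ℤ × ℤ, eLpNorm (fun ω => iteratedSum N (h₁ q.2 · ω) (h₂ q.2 · ω) -
        iteratedSum N (h₁ q.1 · ω) (h₂ q.1 · ω)) (2 * m : ℕ) P ≤
        ∑ i ∈ Finset.range N, eLpNorm (fun ω =>
          V₁ (A i q.2) ω * V₂ (A (i + 1) q.2 - A i q.2) ω -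
            V₁ (A i q.1) ω * V₂ (A (i + 1) q.1 - A i q.1) ω) (2 * m : ℕ) P := by
      intro q
      have h1 : (fun ω => iteratedSum N (h₁ q.2 · ω) (h₂ q.2 · ω) -
          iteratedSum N (h₁ q.1 · ω) (h₂ q.1 · ω)) =ᵐ[P]
          ∑ i ∈ Finset.range N, fun ω =>
            V₁ (A i q.2) ω * V₂ (A (i + 1) q.2 - A i q.2) ω -
              V₁ (A i q.1) ω * V₂ (A (i + 1) q.1 - A i q.1) ω := by
        filter_upwards [hae q.1, hae q.2] with ω c1 c2
        rw [c1, c2, Finset.sum_apply, Finset.sum_sub_distrib]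
      rw [eLpNorm_congr_ae h1]
      refine eLpNorm_sum_le (fun i _ => ?_) hp1
      exact ((hV₁.aestronglyMeasurable _).mul (hV₂.aestronglyMeasurable _)).sub
        ((hV₁.aestronglyMeasurable _).mul (hV₂.aestronglyMeasurable _))
    refine tendsto_of_tendsto_of_tendsto_of_le_of_le tendsto_const_nhds ?_ (fun _ => zero_le) hle
    have := tendsto_finsetSum (Finset.range N) fun i hi =>
      tendsto_eLpNorm_mul_sub_mul hV₁ hV₂ (hlim i (Finset.mem_range.1 hi).le)
        ((hlim (i + 1) (Finset.mem_range.1 hi)).sub (hlim i (Finset.mem_range.1 hi).le)) hp1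
        (ENNReal.natCast_ne_top (2 * m))
    simpa using this
  have hbound : Tendsto (fun N : ℕ => G * ENNReal.ofReal (√K * √(K / N))) atTop (𝓝 0) := by
    have h1 : Tendsto (fun N : ℕ => √K * √(K / N)) atTop (𝓝 (√K * √0)) :=
      ((Real.continuous_sqrt.tendsto _).comp (tendsto_const_div_atTop_nhds_zero_nat K)).const_mul _
    have h2 := ENNReal.Tendsto.const_mul (a := G)
      ((ENNReal.continuous_ofReal.tendsto _).comp h1) (Or.inr hGtop)
    simpa [Function.comp_def] using h2
  rw [ENNReal.tendsto_nhds_zero]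
  intro ε hε
  have hε3 : 0 < ε / 3 := ENNReal.div_pos hε.ne' (by simp)
  obtain ⟨N, hN, hN0⟩ := (((ENNReal.tendsto_nhds_zero.1 hbound) _ hε3).and
    (eventually_ne_atTop 0)).exists
  -- The constant `K` is available for nonnegative indices only.
  have hpos : ∀ᶠ q : ℤ × ℤ in atTop ×ˢ atTop, 0 ≤ q.1 ∧ 0 ≤ q.2 :=
    (eventually_ge_atTop 0).prod_mk (eventually_ge_atTop 0)
  filter_upwards [(ENNReal.tendsto_nhds_zero.1 (hsum N)) _ hε3, hpos] with q hq hq0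
  have happ := fun j hj => (eLpNorm_iterated_sub_iteratedSum_le hV₁ hV₂ hind (hf₁ j) (hf₂ j) hK0
    (hK j hj) hN0 hm).trans hN
  have m1 := fun j => aestronglyMeasurable_iterated hV₁ hV₂ (hf₁ j) (hf₂ j)
  have m2 := fun j => aestronglyMeasurable_iteratedSum hV₁ hV₂ (hf₁ j) (hf₂ j) N
  have hdec : (fun ω => iterated (h₁ q.2 · ω) (h₂ q.2 · ω) -
      iterated (h₁ q.1 · ω) (h₂ q.1 · ω)) =
      (((fun ω => iterated (h₁ q.2 · ω) (h₂ q.2 · ω) - iteratedSum N (h₁ q.2 · ω) (h₂ q.2 · ω)) +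
        fun ω => iteratedSum N (h₁ q.2 · ω) (h₂ q.2 · ω) -
          iteratedSum N (h₁ q.1 · ω) (h₂ q.1 · ω)) -
        fun ω => iterated (h₁ q.1 · ω) (h₂ q.1 · ω) -
          iteratedSum N (h₁ q.1 · ω) (h₂ q.1 · ω)) := by
    ext ω; simp only [Pi.add_apply, Pi.sub_apply]; ring
  rw [hdec]
  refine (eLpNorm_sub_le ((((m1 _).sub (m2 _))).add ((m2 _).sub (m2 _))) ((m1 _).sub (m2 _))
    hp1).trans ?_
  refine (add_le_add (eLpNorm_add_le ((m1 _).sub (m2 _)) ((m2 _).sub (m2 _)) hp1)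
    (happ q.1 hq0.1)).trans ?_
  refine (add_le_add (add_le_add (happ q.2 hq0.2) hq) le_rfl).trans_eq ?_
  exact ENNReal.add_thirds ε

theorem iterated_self_ae (hV : IsIsonormal P V) {f : ℝ → H} {h : ℝ → Ω → ℝ}
    (hf : IsContinuousVersion P V f h) :
    (fun ω => iterated (h · ω) (h · ω)) =ᵐ[P] (1 / 2 : ℝ) • fun ω =>
      V (∫ τ in (0 : ℝ)..1, f τ) ω * V (∫ τ in (0 : ℝ)..1, f τ) ω := by
  filter_upwards [hf.primitive_ae hV 1] with ω hω
  rw [iterated_self (hf.continuous_path ω), Pi.smul_apply, ← hω, smul_eq_mul]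
  ring

theorem memLp_iterated_self (hV : IsIsonormal P V) {f : ℝ → H} {h : ℝ → Ω → ℝ}
    (hf : IsContinuousVersion P V f h) {p : ℝ≥0∞} (hp : 1 ≤ p) (hp' : p ≠ ∞) :
    MemLp (fun ω => iterated (h · ω) (h · ω)) p P := by
  refine ⟨aestronglyMeasurable_iterated hV hV hf hf, ?_⟩
  rw [eLpNorm_congr_ae (iterated_self_ae hV hf), eLpNorm_const_smul]
  refine ENNReal.mul_lt_top (by simp) ?_
  set F := ∫ τ in (0 : ℝ)..1, f τ
  -- Subtracting the null product `V 0 * V 0` reduces the moment bound to the estimate for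
  -- differences of products.
  have h0 : V 0 =ᵐ[P] fun _ => 0 := by simpa using hV.smul_ae 0 0
  have h1 : (fun ω => V F ω * V F ω) =ᵐ[P] fun ω => V F ω * V F ω - V 0 ω * V 0 ω := by
    filter_upwards [h0] with ω hω
    rw [hω]; ring
  rw [eLpNorm_congr_ae h1]
  refine (eLpNorm_mul_sub_mul_le hV hV F 0 F 0 hp).trans_lt ?_
  refine ENNReal.mul_lt_top (ENNReal.pow_lt_top
    (gaussianNorm_ne_top (ENNReal.mul_ne_top (by simp) hp')).lt_top) ?_
  simp [ENNReal.mul_lt_top]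

theorem tendsto_eLpNorm_iterated_self_sub (hV : IsIsonormal P V)
    {f : ℤ → ℝ → H} {h : ℤ → ℝ → Ω → ℝ} (hf : ∀ j, IsContinuousVersion P V (f j) (h j)) {F : H}
    (hF : Tendsto (fun j => ∫ τ in (0 : ℝ)..1, f j τ) atTop (𝓝 F))
    {p : ℝ≥0∞} (hp : 1 ≤ p) (hp' : p ≠ ∞) :
    Tendsto (fun q : ℤ × ℤ => eLpNorm (fun ω => iterated (h q.2 · ω) (h q.2 · ω) -
      iterated (h q.1 · ω) (h q.1 · ω)) p P) (atTop ×ˢ atTop) (𝓝 0) := by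
  have h1 := ENNReal.Tendsto.const_mul (a := ‖(1 / 2 : ℝ)‖ₑ)
    (tendsto_eLpNorm_mul_sub_mul hV hV hF hF hp hp') (Or.inr (by simp))
  rw [mul_zero] at h1
  refine h1.congr fun q => ?_
  rw [← eLpNorm_const_smul]
  refine eLpNorm_congr_ae ?_
  filter_upwards [iterated_self_ae hV (hf q.1), iterated_self_ae hV (hf q.2)] with ω a1 a2
  rw [a1, a2]
  simp only [Pi.smul_apply, smul_eq_mul]
  ring

end

/-! ### The operator attached to a curve -/

/-- The region `{(t, x) | t ∈ [0, 1], 0 < x ≤ c_1(t)}`. -/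
def strip (c : ℝ → Plane) : Set (ℝ × ℝ) := {p | p.1 ∈ Set.Icc 0 1 ∧ p.2 ∈ Set.Ioc 0 (c p.1 0)}

/-- Lebesgue measure on the strip. -/
noncomputable def stripMeasure (c : ℝ → Plane) : Measure (ℝ × ℝ) := volume.restrict (strip c)

/-- The point `(x, c_2(t))` of the plane. -/
noncomputable def stripPoint (c : ℝ → Plane) (p : ℝ × ℝ) : Plane := !₂[p.2, c p.1 1]

section Curve

variable {c : ℝ → Plane}

theorem Curves.continuous (hc : c ∈ Curves) : Continuous c := hc.1.continuous

theorem Curves.continuous_deriv (hc : c ∈ Curves) : Continuous fun t => deriv c t 1 := by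
  have h : Continuous (deriv c) := hc.1.continuous_deriv (by simp)
  fun_prop

theorem Curves.deriv_eq_zero (hc : c ∈ Curves) {t : ℝ} (ht : t ∉ Set.Icc (0 : ℝ) 1) :
    deriv c t 1 = 0 := by
  have h : deriv c t = 0 := image_eq_zero_of_notMem_tsupport fun h => ht (hc.2.1 h)
  simp [h]

theorem measurableSet_strip (hc : Continuous c) : MeasurableSet (strip c) := by
  have h1 : MeasurableSet {p : ℝ × ℝ | p.1 ∈ Set.Icc (0 : ℝ) 1} := measurable_fst measurableSet_Icc
  have h2 : MeasurableSet {p : ℝ × ℝ | 0 < p.2} := measurableSet_lt (by fun_prop) (by fun_prop)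
  have h3 : MeasurableSet {p : ℝ × ℝ | p.2 ≤ c p.1 0} := by
    refine measurableSet_le measurable_snd ?_
    have : Continuous fun p : ℝ × ℝ => c p.1 0 := by fun_prop
    exact this.measurable
  exact h1.inter (h2.inter h3)

theorem continuous_stripPoint (hc : Continuous c) : Continuous (stripPoint c) := by
  unfold stripPoint
  fun_prop

theorem exists_bound_strip (hc : Continuous c) : ∃ A, 0 ≤ A ∧ ∀ t ∈ Set.Icc (0 : ℝ) 1, c t 0 ≤ A := by
  have h : Continuous fun t => c t 0 := by fun_prop
  obtain ⟨A, hA⟩ := isCompact_Icc.exists_bound_of_continuousOn (s := Set.Icc (0 : ℝ) 1)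
    h.continuousOn
  exact ⟨A, (norm_nonneg _).trans (hA 0 (by simp)), fun t ht => (le_abs_self _).trans (hA t ht)⟩

theorem isFiniteMeasure_stripMeasure (hc : Continuous c) : IsFiniteMeasure (stripMeasure c) := by
  obtain ⟨A, -, hA⟩ := exists_bound_strip hc
  refine ⟨?_⟩
  rw [stripMeasure, Measure.restrict_apply_univ]
  have hsub : strip c ⊆ Set.Icc (0 : ℝ) 1 ×ˢ Set.Icc 0 A := fun p hp =>
    ⟨hp.1, hp.2.1.le, hp.2.2.trans (hA _ hp.1)⟩
  exact (measure_mono hsub).trans_lt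
    (isCompact_Icc.prod isCompact_Icc).measure_lt_top

/-- Iterated integrals over the strip. -/
theorem integral_stripMeasure (hc : Continuous c) {E : Type*} [NormedAddCommGroup E]
    [NormedSpace ℝ E] {φ : ℝ × ℝ → E} (hφ : Integrable φ (stripMeasure c))
    (hpos : ∀ t, 0 < c t 0) :
    ∫ p, φ p ∂(stripMeasure c) =
      ∫ t in Set.Icc (0 : ℝ) 1, ∫ x in (0 : ℝ)..c t 0, φ (t, x) := by
  have hm := measurableSet_strip hc
  rw [stripMeasure, ← integral_indicator hm, Measure.volume_eq_prod, integral_prod,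
    ← integral_indicator measurableSet_Icc]
  · refine integral_congr_ae (Eventually.of_forall fun t => ?_)
    by_cases ht : t ∈ Set.Icc (0 : ℝ) 1
    · simp only [Set.indicator_of_mem ht]
      rw [intervalIntegral.integral_of_le (hpos t).le, ← integral_indicator measurableSet_Ioc]
      refine integral_congr_ae (Eventually.of_forall fun x => ?_)
      by_cases hx : x ∈ Set.Ioc 0 (c t 0)
      · rw [Set.indicator_of_mem hx]
        exact Set.indicator_of_mem (show (t, x) ∈ strip c from ⟨ht, hx⟩) _
      · rw [Set.indicator_of_notMem hx]
        exact Set.indicator_of_notMem (show (t, x) ∉ strip c from fun h => hx h.2) _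
    · simp only [Set.indicator_of_notMem ht]
      refine integral_eq_zero_of_ae (Eventually.of_forall fun x => ?_)
      exact Set.indicator_of_notMem (show (t, x) ∉ strip c from fun h => ht h.1) _
  · rw [← Measure.volume_eq_prod]
    exact (integrable_indicator_iff hm).2 hφ

theorem integrable_stripMeasure (hc : c ∈ Curves) {g : Plane → ℝ} (hg : Measurable g) {A : ℝ}
    (hA : ∀ x, |g x| ≤ A) {h : ℝ → ℝ} (hh : Measurable h) {B : ℝ} (hB : ∀ t, |h t| ≤ B) :
    Integrable (fun p => g (stripPoint c p) * h p.1 * deriv c p.1 1) (stripMeasure c) := by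
  have hc0 := Curves.continuous hc
  have hd := Curves.continuous_deriv hc
  obtain ⟨D, hD⟩ := isCompact_Icc.exists_bound_of_continuousOn (s := Set.Icc (0 : ℝ) 1)
    hd.continuousOn
  have := isFiniteMeasure_stripMeasure hc0
  refine Integrable.of_bound (C := A * B * D) ?_ ?_
  · exact (((hg.comp (continuous_stripPoint hc0).measurable).mul
      (hh.comp measurable_fst)).mul (hd.measurable.comp measurable_fst)).aestronglyMeasurable
  · rw [stripMeasure, ae_restrict_iff' (measurableSet_strip hc0)]
    refine Eventually.of_forall fun p hp => ?_
    rw [norm_mul, norm_mul]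
    have hA0 : 0 ≤ A := (abs_nonneg _).trans (hA 0)
    have hB0 : 0 ≤ B := (abs_nonneg _).trans (hB 0)
    have := hA (stripPoint c p)
    have := hB p.1
    have := hD p.1 hp.1
    gcongr <;> assumption

/-- Outside `[0, 1]` the derivative of the curve vanishes, so nothing is lost on the strip. There
the measure is finite and the integrand bounded, and Fubini applies. -/
theorem hatE_eq (hc : c ∈ Curves) {g : Plane → ℝ} (hg : Measurable g) {A : ℝ}
    (hA : ∀ x, |g x| ≤ A) {h : ℝ → ℝ} (hh : Measurable h) {B : ℝ} (hB : ∀ t, |h t| ≤ B) :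
    hatE c g h = ∫ p, g (stripPoint c p) * h p.1 * deriv c p.1 1 ∂(stripMeasure c) := by
  rw [integral_stripMeasure (Curves.continuous hc) (integrable_stripMeasure hc hg hA hh hB) hc.2.2,
    hatE, ← integral_indicator measurableSet_Icc]
  refine integral_congr_ae (Eventually.of_forall fun t => ?_)
  by_cases ht : t ∈ Set.Icc (0 : ℝ) 1
  · simp only [Set.indicator_of_mem ht, stripPoint]
  · simp only [Set.indicator_of_notMem ht, Curves.deriv_eq_zero hc ht, mul_zero]
    simp

theorem hatE_const_mul (g : Plane → ℝ) (h : ℝ → ℝ) (a : ℝ) :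
    hatE c g (fun t => a * h t) = a * hatE c g h := by
  unfold hatE
  rw [← integral_const_mul]
  refine integral_congr_ae (Eventually.of_forall fun t => ?_)
  simp only
  rw [← intervalIntegral.integral_const_mul]
  congr 1
  ext x
  ring

/-- A bounded Borel representative of the image of a bounded function. -/
theorem exists_bounded_image (hc : c ∈ CurvesInfty) : ∃ M : ℝ, 0 < M ∧ ∀ h : ℝ → ℝ,
    Measurable h → ∀ B : ℝ, 0 < B → (∀ t, |h t| ≤ B) → ∃ u : Plane → ℝ, Measurable u ∧
      (∀ x, |u x| ≤ B * M) ∧ MemLp u 2 ∧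
      ∀ g : Plane → ℝ, MemLp g 2 → ∫ x, g x * u x = hatE c g h := by
  obtain ⟨hc0, M, hM⟩ := hc
  refine ⟨max M 1, by positivity, fun h hh B hB hhB => ?_⟩
  have hn : ∀ t, ‖B⁻¹ * h t‖ ≤ 1 := fun t => by
    rw [norm_mul, norm_inv, Real.norm_of_nonneg hB.le, inv_mul_le_iff₀ hB, mul_one]
    exact hhB t
  have hm : AEStronglyMeasurable (fun t => B⁻¹ * h t) volume :=
    (hh.const_mul _).aestronglyMeasurable
  obtain ⟨u', ⟨hu', hu'E⟩, hu'M⟩ := hM (fun t => B⁻¹ * h t)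
    (memLp_top_of_bound hm 1 (Eventually.of_forall hn)) (by
      refine (eLpNorm_le_of_ae_bound (Eventually.of_forall hn)).trans ?_
      simp)
  have hbd : ∀ᵐ x, |u' x| ≤ max M 1 := by
    rw [eLpNorm_exponent_top] at hu'M
    filter_upwards [ae_le_eLpNormEssSup (f := u')] with x hx
    have h1 := (hx.trans hu'M).trans (ENNReal.ofReal_le_ofReal (le_max_left M 1))
    rw [← ofReal_norm, ENNReal.ofReal_le_ofReal_iff (by positivity)] at h1
    exact h1
  set v := hu'.aestronglyMeasurable.mk u' with hv
  have hvm : Measurable v := hu'.aestronglyMeasurable.stronglyMeasurable_mk.measurable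
  have hvu : u' =ᵐ[volume] v := hu'.aestronglyMeasurable.ae_eq_mk
  -- Truncating a Borel representative makes the almost sure bound hold everywhere without changing
  -- its class; the factor `B` undoes the normalization of `h`.
  set w : Plane → ℝ := fun x => B * max (-(max M 1)) (min (v x) (max M 1)) with hw
  have hwu : w =ᵐ[volume] fun x => B * u' x := by
    filter_upwards [hvu, hbd] with x h1 h2
    rw [abs_le] at h2
    rw [hw]
    simp only
    rw [← h1, min_eq_left h2.2, max_eq_right h2.1]
  refine ⟨w, ((measurable_const.max (hvm.min measurable_const)).const_mul B), fun x => ?_,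
    (memLp_congr_ae hwu).2 (hu'.const_mul B), fun g hg => ?_⟩
  · rw [hw, abs_mul, abs_of_pos hB]
    gcongr
    rw [abs_le]
    refine ⟨le_max_left _ _, max_le ?_ (min_le_right _ _)⟩
    linarith [le_max_right M 1]
  · have h1 : ∫ x, g x * w x = B * ∫ x, g x * u' x := by
      rw [← integral_const_mul]
      refine integral_congr_ae ?_
      filter_upwards [hwu] with x hx
      rw [hx]; ring
    rw [h1, hu'E g hg, hatE_const_mul, ← mul_assoc, mul_inv_cancel₀ hB.ne', one_mul]

/-- The operator `E_c` is bounded on `L²`. -/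
theorem exists_image_norm_le (hc : c ∈ CurvesInfty) : ∃ C : ℝ, 0 ≤ C ∧ ∀ h : ℝ → ℝ,
    Measurable h → ∀ B : ℝ, (∀ t, |h t| ≤ B) → ∃ u : Lp ℝ 2 (volume : Measure Plane),
      (∀ g : Plane → ℝ, MemLp g 2 → ∫ x, g x * u x = hatE c g h) ∧
      ‖u‖ ^ 2 ≤ C * ∫ t in Set.Icc (0 : ℝ) 1, h t ^ 2 := by
  have hc0 := hc.1
  have hcc := Curves.continuous hc0
  have hd := Curves.continuous_deriv hc0
  obtain ⟨M, hM, hEx⟩ := exists_bounded_image hc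
  obtain ⟨A, hA0, hA⟩ := exists_bound_strip hcc
  obtain ⟨D, hD⟩ := isCompact_Icc.exists_bound_of_continuousOn (s := Set.Icc (0 : ℝ) 1)
    hd.continuousOn
  have hD0 : 0 ≤ D := (norm_nonneg _).trans (hD 0 (by simp))
  refine ⟨M * (A * D), by positivity, fun h hh B hB => ?_⟩
  -- The bounded image `σ` of this sign turns the integral of `u ^ 2` against `|c_2'|` over the
  -- strip into the plane integral of `u ^ 2 * σ`, which is at most `M` times `‖u‖ ^ 2`.
  set sg : ℝ → ℝ := fun t => SignType.sign (deriv c t 1) with hsg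
  have hsgm : Measurable sg := by
    have h1 : Measurable (fun x : ℝ => ((SignType.sign x : SignType) : ℝ)) := by
      have : (fun x : ℝ => ((SignType.sign x : SignType) : ℝ)) =
          fun x => if 0 < x then 1 else if x < 0 then -1 else 0 := by
        ext x
        rw [sign_apply]
        split_ifs <;> simp
      rw [this]
      exact Measurable.ite measurableSet_Ioi measurable_const
        (Measurable.ite measurableSet_Iio measurable_const measurable_const)
    exact h1.comp hd.measurable
  have hsgb : ∀ t, |sg t| ≤ 1 := by
    intro t
    rw [hsg]
    simp only
    rw [sign_apply]
    split_ifs <;> simp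
  have hsgd : ∀ t, sg t * deriv c t 1 = |deriv c t 1| := fun t => sign_mul_self _
  obtain ⟨σ, hσm, hσb, hσL, hσE⟩ := hEx sg hsgm 1 one_pos hsgb
  obtain ⟨u, hum, hub, huL, huE⟩ := hEx h hh (max B 1) (by positivity)
    fun t => (hB t).trans (le_max_left _ _)
  refine ⟨huL.toLp u, fun g hg => ?_, ?_⟩
  · rw [← huE g hg]
    refine integral_congr_ae ?_
    filter_upwards [huL.coeFn_toLp] with x hx
    rw [hx]
  have hnorm : ‖huL.toLp u‖ ^ 2 = ∫ x, u x * u x := by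
    rw [← real_inner_self_eq_norm_sq, L2.inner_def]
    refine integral_congr_ae ?_
    filter_upwards [huL.coeFn_toLp] with x hx
    rw [hx]; rfl
  set U := max B 1 * M with hU
  have hu2b : ∀ x, |u x * u x| ≤ U * U := fun x => by
    rw [abs_mul]
    exact mul_le_mul (hub x) (hub x) (abs_nonneg _) (by positivity)
  -- Boundedness of `u` puts its square in `L²`, so that the square may be tested against `σ`.
  have hu2L : MemLp (fun x => u x * u x) 2 := by
    refine (huL.const_mul U).mono (hum.mul hum).aestronglyMeasurable
      (Eventually.of_forall fun x => ?_)
    rw [norm_mul, norm_mul, Real.norm_of_nonneg (by positivity : 0 ≤ U)]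
    exact mul_le_mul_of_nonneg_right (hub x) (norm_nonneg _)
  have hu2m : Measurable fun x => u x * u x := hum.mul hum
  have e1 : ∫ x, u x * u x = ∫ p, u (stripPoint c p) * h p.1 * deriv c p.1 1 ∂(stripMeasure c) := by
    rw [huE u huL, hatE_eq hc0 hum hub hh hB]
  have e2 : ∫ x, u x * u x * σ x =
      ∫ p, u (stripPoint c p) * u (stripPoint c p) * sg p.1 * deriv c p.1 1 ∂(stripMeasure c) := by
    rw [hσE _ hu2L, hatE_eq hc0 hu2m hu2b hsgm hsgb]
  have i1 := integrable_stripMeasure hc0 hum hub hh hB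
  have i2 := integrable_stripMeasure hc0 hu2m hu2b hsgm hsgb
  have hfin := isFiniteMeasure_stripMeasure hcc
  have hB0 : 0 ≤ B := (abs_nonneg _).trans (hB 0)
  have i3 : Integrable (fun p : ℝ × ℝ => h p.1 ^ 2 * D) (stripMeasure c) := by
    refine Integrable.of_bound (C := B ^ 2 * D)
      (((hh.comp measurable_fst).pow_const 2).mul_const D).aestronglyMeasurable
      (Eventually.of_forall fun p => ?_)
    rw [norm_mul, norm_pow, Real.norm_of_nonneg hD0]
    have := hB p.1
    gcongr
    exact this
  have e3 : ∫ p, h p.1 ^ 2 * D ∂(stripMeasure c) ≤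
      A * D * ∫ t in Set.Icc (0 : ℝ) 1, h t ^ 2 := by
    rw [integral_stripMeasure hcc i3 hc0.2.2, ← integral_const_mul]
    have hint : IntegrableOn (fun t => h t ^ 2) (Set.Icc (0 : ℝ) 1) volume := by
      refine Integrable.of_bound (C := B ^ 2) (hh.pow_const 2).aestronglyMeasurable
        (Eventually.of_forall fun t => ?_)
      rw [norm_pow]
      have := hB t
      gcongr
      exact this
    refine integral_mono_of_nonneg (Eventually.of_forall fun t => ?_) (hint.const_mul (A * D)) ?_
    · simp only [intervalIntegral.integral_const, Pi.zero_apply, smul_eq_mul, sub_zero]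
      have := (hc0.2.2 t).le
      positivity
    · rw [EventuallyLE, ae_restrict_iff' measurableSet_Icc]
      refine Eventually.of_forall fun t ht => ?_
      simp only [intervalIntegral.integral_const, smul_eq_mul, sub_zero]
      calc c t 0 * (h t ^ 2 * D) ≤ A * (h t ^ 2 * D) := by
            gcongr
            exact hA t ht
        _ = A * D * h t ^ 2 := by ring
  have e4 : ∫ x, u x * u x * σ x ≤ M * ∫ x, u x * u x := by
    rw [← integral_const_mul]
    have hint : Integrable (fun x => u x * u x) := huL.integrable_mul huL
    refine integral_mono (hu2L.integrable_mul hσL) (hint.const_mul M) fun x => ?_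
    have h1 := (le_abs_self _).trans (hσb x)
    rw [one_mul] at h1
    simp only
    nlinarith [mul_self_nonneg (u x)]
  -- The inequality `2 M a b d ≤ |d| (a² + M² b²)`, weighted by `M` so that half of the left side
  -- can later absorb the term with `σ`.
  have key : ∀ p ∈ strip c, 2 * M * (u (stripPoint c p) * h p.1 * deriv c p.1 1) ≤
      u (stripPoint c p) * u (stripPoint c p) * sg p.1 * deriv c p.1 1 +
        M ^ 2 * (h p.1 ^ 2 * D) := by
    intro p hp
    have h1 : |deriv c p.1 1| ≤ D := hD p.1 hp.1
    have h2 := hsgd p.1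
    set d := deriv c p.1 1
    set a := u (stripPoint c p)
    set b := h p.1
    rw [show a * a * sg p.1 * d = a * a * (sg p.1 * d) by ring, h2]
    have h3 : M ^ 2 * (b ^ 2 * |d|) ≤ M ^ 2 * (b ^ 2 * D) := by gcongr
    rcases abs_cases d with ⟨h4, h5⟩ | ⟨h4, h5⟩
    · rw [h4] at h3 ⊢
      nlinarith [mul_nonneg h5 (sq_nonneg (a - M * b))]
    · rw [h4] at h3 ⊢
      nlinarith [mul_nonneg (neg_nonneg.2 h5.le) (sq_nonneg (a + M * b))]
  have hI : 2 * M * ∫ x, u x * u x ≤ (∫ x, u x * u x * σ x) +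
      M ^ 2 * ∫ p, h p.1 ^ 2 * D ∂(stripMeasure c) := by
    rw [e1, e2, ← integral_const_mul, ← integral_const_mul (M ^ 2),
      ← integral_add i2 (i3.const_mul _)]
    refine integral_mono_ae (i1.const_mul _) (i2.add (i3.const_mul _)) ?_
    rw [stripMeasure, EventuallyLE, ae_restrict_iff' (measurableSet_strip hcc)]
    exact Eventually.of_forall key
  rw [hnorm]
  -- By `e4` the term with `σ` is at most `M * ∫ u²` and is absorbed on the left.
  have hfinal : M * ∫ x, u x * u x ≤ M * (M * (A * D) * ∫ t in Set.Icc (0 : ℝ) 1, h t ^ 2) := by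
    nlinarith [mul_le_mul_of_nonneg_left e3 (sq_nonneg M)]
  exact le_of_mul_le_mul_left hfinal hM

end Curve

/-! ### Translations and smoothing in `L²` -/

/-- The real Hilbert space `L²` of the plane. -/
abbrev PlaneL2 : Type := Lp ℝ 2 (volume : Measure Plane)

/-- The translate `y ↦ f (a + y)`. -/
noncomputable def translate (a : Plane) (f : PlaneL2) : PlaneL2 := DomAddAct.mk a +ᵥ f

theorem translate_ae (a : Plane) (f : PlaneL2) :
    translate a f =ᵐ[volume] fun y => f (a + y) :=
  DomAddAct.vadd_Lp_ae_eq _ _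

theorem norm_translate (a : Plane) (f : PlaneL2) : ‖translate a f‖ = ‖f‖ :=
  DomAddAct.norm_vadd_Lp _ _

theorem translate_zero (f : PlaneL2) : translate 0 f = f :=
  zero_vadd _ f

theorem continuous_translate (f : PlaneL2) : Continuous fun a => translate a f := by
  have : Fact ((2 : ℝ≥0∞) ≠ ∞) := ⟨by simp⟩
  have h : Continuous fun a : Plane => (DomAddAct.mk a : Planeᵈᵃᵃ) := DomAddAct.continuous_mk
  exact h.vadd continuous_const

/-- The Schwartz function `y ↦ κ (x - y)`. -/
noncomputable def reflectedShift (κ : 𝓢(Plane, ℝ)) (x : Plane) : 𝓢(Plane, ℝ) :=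
  SchwartzMap.compSubConstCLM ℝ x (SchwartzMap.compCLMOfContinuousLinearEquiv ℝ
    (ContinuousLinearEquiv.neg ℝ) κ)

theorem reflectedShift_apply (κ : 𝓢(Plane, ℝ)) (x y : Plane) :
    reflectedShift κ x y = κ (x - y) := by
  rw [← neg_sub y x]
  rfl

/-- The class of `y ↦ κ (x - y)` in `L²`. -/
noncomputable def shiftL2 (κ : 𝓢(Plane, ℝ)) (x : Plane) : PlaneL2 :=
  (reflectedShift κ x).toLp 2 volume

theorem shiftL2_ae (κ : 𝓢(Plane, ℝ)) (x : Plane) :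
    shiftL2 κ x =ᵐ[volume] fun y => κ (x - y) :=
  ((reflectedShift κ x).coeFn_toLp 2 volume).trans
    (Eventually.of_forall (reflectedShift_apply κ x))

theorem shiftL2_eq_translate (κ : 𝓢(Plane, ℝ)) (x : Plane) :
    shiftL2 κ x = translate (-x) (shiftL2 κ 0) := by
  refine Lp.ext ((shiftL2_ae κ x).trans ?_)
  have h1 : (fun y => shiftL2 κ 0 (-x + y)) =ᵐ[volume] fun y => κ (0 - (-x + y)) :=
    (measurePreserving_add_left volume (-x)).quasiMeasurePreserving.ae_eq_comp (shiftL2_ae κ 0)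
  refine EventuallyEq.symm ((translate_ae (-x) _).trans (h1.trans ?_))
  refine Eventually.of_forall fun y => ?_
  simp only
  congr 1
  abel

theorem continuous_shiftL2 (κ : 𝓢(Plane, ℝ)) : Continuous (shiftL2 κ) := by
  have h : shiftL2 κ = fun x => translate (-x) (shiftL2 κ 0) := funext (shiftL2_eq_translate κ)
  rw [h]
  exact (continuous_translate _).comp continuous_neg

theorem norm_shiftL2 (κ : 𝓢(Plane, ℝ)) (x : Plane) : ‖shiftL2 κ x‖ = ‖shiftL2 κ 0‖ := by
  rw [shiftL2_eq_translate, norm_translate]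

theorem inner_shiftL2 (κ g : 𝓢(Plane, ℝ)) (x : Plane) :
    inner ℝ (g.toLp 2 volume) (shiftL2 κ x) = ∫ z, κ z * g (x - z) := by
  rw [L2.inner_def, ← integral_sub_left_eq_self (fun z => κ z * g (x - z)) volume x]
  refine integral_congr_ae ?_
  filter_upwards [g.coeFn_toLp 2 volume, shiftL2_ae κ x] with y h1 h2
  rw [h1, h2, sub_sub_cancel]
  rfl

/-- The smoothing operator `u ↦ ∫ κ(z) u(z + ·) dz`. -/
noncomputable def smoothing (κ : Plane → ℝ) (u : PlaneL2) : PlaneL2 :=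
  ∫ z, κ z • translate z u

theorem integrable_smoothing {κ : Plane → ℝ} (hκ : Integrable κ) {r : Plane → Plane}
    (hr : Continuous r) (u : PlaneL2) : Integrable (fun z => κ z • translate (r z) u) := by
  have hm : AEStronglyMeasurable (fun z => translate (r z) u) volume :=
    ((continuous_translate u).comp hr).aestronglyMeasurable
  refine (hκ.norm.mul_const ‖u‖).mono' (hκ.aestronglyMeasurable.smul hm)
    (Eventually.of_forall fun z => ?_)
  rw [norm_smul, norm_translate]

theorem norm_smoothing_le (κ : Plane → ℝ) (u : PlaneL2) :
    ‖smoothing κ u‖ ≤ (∫ z, ‖κ z‖) * ‖u‖ := by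
  refine (norm_integral_le_integral_norm _).trans_eq ?_
  simp_rw [norm_smul, norm_translate]
  rw [integral_mul_const]

theorem inner_smoothing (κ g : 𝓢(Plane, ℝ)) (u : PlaneL2) :
    inner ℝ (g.toLp 2 volume) (smoothing κ u) = ∫ z, κ z * ∫ x, g (x - z) * u x := by
  have hi : Integrable (fun z => κ z • translate z u) :=
    integrable_smoothing κ.integrable continuous_id u
  rw [smoothing, ← integral_inner hi]
  refine integral_congr_ae (Eventually.of_forall fun z => ?_)
  simp only [inner_smul_right]
  congr 1
  rw [L2.inner_def, ← integral_add_left_eq_self (fun x => g (x - z) * u x) z]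
  refine integral_congr_ae ?_
  filter_upwards [g.coeFn_toLp 2 volume, translate_ae z u] with y h1 h2
  rw [h1, h2, add_sub_cancel_left]
  simp [mul_comm]

/-- The `L²` function that represents the derivative of a smoothed path at time `t`. -/
noncomputable def velocity (κ : 𝓢(Plane, ℝ)) (c : ℝ → Plane) (t : ℝ) : PlaneL2 :=
  deriv c t 1 • ∫ ξ in (0 : ℝ)..c t 0, shiftL2 κ !₂[ξ, c t 1]

section

variable {c : ℝ → Plane}

theorem continuous_velocity (κ : 𝓢(Plane, ℝ)) (hc : c ∈ Curves) :
    Continuous (velocity κ c) := by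
  have hc0 := Curves.continuous hc
  refine (Curves.continuous_deriv hc).smul ?_
  refine intervalIntegral.continuous_parametric_intervalIntegral_of_continuous
    (f := fun t ξ => shiftL2 κ !₂[ξ, c t 1]) ?_ (by fun_prop)
  refine (continuous_shiftL2 κ).comp (g := shiftL2 κ) (f := fun p : ℝ × ℝ => !₂[p.2, c p.1 1]) ?_
  fun_prop

theorem inner_velocity (κ : 𝓢(Plane, ℝ)) (c : ℝ → Plane) (g : PlaneL2) (t : ℝ) :
    inner ℝ g (velocity κ c t) =
      ∫ ξ in (0 : ℝ)..c t 0, inner ℝ g (shiftL2 κ !₂[ξ, c t 1]) * deriv c t 1 := by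
  have hcont : Continuous fun ξ : ℝ => shiftL2 κ !₂[ξ, c t 1] :=
    (continuous_shiftL2 κ).comp (by fun_prop)
  have h := (innerSL ℝ g).intervalIntegral_comp_comm
    (hcont.intervalIntegrable (μ := volume) 0 (c t 0))
  simp only [innerSL_apply_apply] at h
  rw [velocity, inner_smul_right, ← h, mul_comm, intervalIntegral.integral_mul_const]

/-- Weighted integrals of the velocity are smoothings of the image under `E_c`. -/
theorem integral_smul_velocity (κ : 𝓢(Plane, ℝ)) (hc : c ∈ Curves) {h : ℝ → ℝ}
    (hh : Measurable h) {B : ℝ} (hB : ∀ t, |h t| ≤ B) {u : PlaneL2}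
    (hu : ∀ g : Plane → ℝ, MemLp g 2 → ∫ x, g x * u x = hatE c g h) :
    ∫ t in Set.Icc (0 : ℝ) 1, h t • velocity κ c t = smoothing κ u := by
  have hc0 := Curves.continuous hc
  have hfin := isFiniteMeasure_stripMeasure hc0
  have hvel := continuous_velocity κ hc
  -- Schwartz functions are dense in `L²`, so both sides are compared by pairing with a Schwartz
  -- function `g`, for which all integrands are bounded and Fubini is available.
  refine DenseRange.eq_of_inner_right (𝕜 := ℝ)
    (SchwartzMap.denseRange_toLpCLM (E := Plane) (F := ℝ) (p := 2) (μ := volume) (by simp))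
    fun g => ?_
  rw [SchwartzMap.toLpCLM_apply, inner_smoothing]
  set G : Plane → ℝ := fun x => inner ℝ (g.toLp 2 volume) (shiftL2 κ x) with hG
  have hGc : Continuous G := continuous_const.inner (continuous_shiftL2 κ)
  have hGb : ∀ x, |G x| ≤ ‖g.toLp 2 volume‖ * ‖shiftL2 κ 0‖ := fun x => by
    rw [← norm_shiftL2 κ x]
    exact abs_real_inner_le_norm _ _
  have hint : IntegrableOn (fun t => h t • velocity κ c t) (Set.Icc (0 : ℝ) 1) := by
    have h1 : IntegrableOn (velocity κ c) (Set.Icc (0 : ℝ) 1) :=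
      hvel.continuousOn.integrableOn_compact isCompact_Icc
    refine h1.bdd_smul B hh.aestronglyMeasurable (Eventually.of_forall hB)
  have e1 : inner ℝ (g.toLp 2 volume) (∫ t in Set.Icc (0 : ℝ) 1, h t • velocity κ c t) =
      ∫ p, G (stripPoint c p) * h p.1 * deriv c p.1 1 ∂(stripMeasure c) := by
    rw [← integral_inner hint, integral_stripMeasure hc0
      (integrable_stripMeasure hc hGc.measurable hGb hh hB) hc.2.2]
    refine integral_congr_ae (Eventually.of_forall fun t => ?_)
    simp only [inner_smul_right]
    rw [inner_velocity, ← intervalIntegral.integral_const_mul]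
    congr 1
    ext ξ
    simp only [hG, stripPoint]
    ring
  obtain ⟨A, hA⟩ : ∃ A, ∀ x, |g x| ≤ A := by
    obtain ⟨A, hA⟩ := g.decay 0 0
    exact ⟨A, fun x => by simpa using hA.2 x⟩
  have hgm : Measurable g := g.continuous.measurable
  have e2 : ∀ z, ∫ x, g (x - z) * u x =
      ∫ p, g (stripPoint c p - z) * h p.1 * deriv c p.1 1 ∂(stripMeasure c) := by
    intro z
    have hL : MemLp (fun x => g (x - z)) 2 volume :=
      (g.memLp 2 volume).comp_measurePreserving (measurePreserving_sub_right volume z)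
    rw [hu _ hL, hatE_eq hc (g := fun x => g (x - z)) (hgm.comp (measurable_id.sub_const z))
      (fun x => hA _) hh hB]
  rw [e1]
  simp_rw [e2, ← integral_const_mul]
  -- Exchanges the smoothing variable `z` with the point of the strip; `κ` is integrable and `g`
  -- bounded.
  rw [integral_integral_swap]
  · refine integral_congr_ae (Eventually.of_forall fun p => ?_)
    simp only [hG]
    rw [inner_shiftL2, mul_assoc, ← integral_mul_const]
    refine integral_congr_ae (Eventually.of_forall fun z => ?_)
    simp only
    ring
  · have i1 : Integrable (fun p : ℝ × ℝ => h p.1 * deriv c p.1 1) (stripMeasure c) := by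
      simpa using integrable_stripMeasure hc (g := fun _ => 1) measurable_const (A := 1)
        (by simp) hh hB
    have i2 := (κ.integrable (μ := volume)).mul_prod i1
    have i3 : AEStronglyMeasurable (fun q : Plane × (ℝ × ℝ) => g (stripPoint c q.2 - q.1))
        ((volume : Measure Plane).prod (stripMeasure c)) := by
      refine Continuous.aestronglyMeasurable ?_
      exact g.continuous.comp (((continuous_stripPoint hc0).comp continuous_snd).sub continuous_fst)
    refine (i2.bdd_mul (c := A) i3 (Eventually.of_forall fun q => hA _)).congr
      (Eventually.of_forall fun q => ?_)
    simp only [Function.uncurry]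
    ring

end

/-! ### Scaling of the Littlewood-Paley kernels -/

namespace LPCutoff

variable (ρ : LPCutoff)

/-- Halving the argument shifts the summation index by one and uncovers the term `ρ_0(ξ)`. Adding a
dyadic block is therefore a dilation, which iterates to `chi_eq`. -/
theorem chi₀_half (ξ : Plane) : ρ.chi₀ ((1 / 2 : ℝ) • ξ) = ρ.chi₀ ξ + ρ.toFun ξ := by
  rcases eq_or_ne ξ 0 with rfl | h0
  · have h1 : ρ.toFun 0 = 0 := ρ.eq_zero_of_lt (by simp)
    simp [chi₀, h1]
  have h1 : (1 / 2 : ℝ) • ξ ≠ 0 := smul_ne_zero (by norm_num) h0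
  have hpos : 0 < ‖ξ‖ := norm_pos_iff.2 h0
  unfold chi₀
  rw [if_neg h0, if_neg h1]
  have h2 : ∀ k : ℕ, (2 : ℝ) ^ (k + 1) • ((1 / 2 : ℝ) • ξ) = (2 : ℝ) ^ k • ξ := fun k => by
    rw [smul_smul]; congr 1; ring
  simp_rw [h2]
  have hsum : Summable fun k : ℕ => ρ.toFun ((2 : ℝ) ^ k • ξ) := by
    obtain ⟨m, hm⟩ := pow_unbounded_of_one_lt (2 / ‖ξ‖) (one_lt_two : (1 : ℝ) < 2)
    refine summable_of_ne_finset_zero (s := Finset.range m) fun k hk => ?_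
    apply ρ.eq_zero_of_gt
    rw [norm_two_pow_smul]
    rw [div_lt_iff₀ hpos] at hm
    have h3 : (2 : ℝ) ^ m ≤ 2 ^ k := pow_le_pow_right₀ one_le_two (by simpa using hk)
    nlinarith
  rw [hsum.tsum_eq_zero_add, pow_zero, one_smul, add_comm]

theorem chi_eq {j : ℤ} (hj : 0 ≤ j) (ξ : Plane) : ρ.chi j ξ = ρ.chi₀ ((2 : ℝ) ^ (-j) • ξ) := by
  induction j, hj using Int.leInduction with
  | base => simp [chi, block, show Finset.Ico (-1 : ℤ) 0 = {-1} from rfl]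
  | succ j hj ih =>
    have h1 : ρ.chi (j + 1) ξ = ρ.chi j ξ + ρ.block j ξ := by
      unfold chi
      rw [← Finset.insert_Ico_right_eq_Ico_add_one (by omega),
        Finset.sum_insert Finset.right_notMem_Ico, add_comm]
    rw [h1, ih, block, if_neg (by omega), ← chi₀_half, smul_smul]
    congr 2
    rw [neg_add, zpow_add₀ two_ne_zero, zpow_neg_one]
    ring

theorem kernel_eq {j : ℤ} (hj : 0 ≤ j) (x : Plane) :
    ρ.kernel j x = ((2 : ℝ) ^ j) ^ 2 * ρ.kernel 0 ((2 : ℝ) ^ j • x) := by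
  change (invFourier (ρ.chi j) x).re =
    ((2 : ℝ) ^ j) ^ 2 * (invFourier (ρ.chi 0) ((2 : ℝ) ^ j • x)).re
  have h2 : (0 : ℝ) < 2 ^ j := by positivity
  have h1 : invFourier (ρ.chi j) x =
      (((2 : ℝ) ^ j) ^ 2) • invFourier (ρ.chi 0) ((2 : ℝ) ^ j • x) := by
    unfold invFourier
    rw [smul_comm]
    congr 1
    have h := Measure.integral_comp_smul (volume : Measure Plane) (fun z : Plane =>
      Complex.exp (Complex.I * (inner ℝ z ((2 : ℝ) ^ j • x) : ℝ)) * (ρ.chi 0 z : ℂ))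
      ((2 : ℝ) ^ (-j))
    have h3 : |(((2 : ℝ) ^ (-j)) ^ Module.finrank ℝ Plane)⁻¹| = ((2 : ℝ) ^ j) ^ 2 := by
      rw [finrank_euclideanSpace, Fintype.card_fin, zpow_neg, inv_pow, inv_inv,
        abs_of_pos (by positivity)]
    rw [h3] at h
    rw [← h]
    refine integral_congr_ae (Eventually.of_forall fun z => ?_)
    simp only
    rw [ρ.chi_eq hj, ρ.chi_eq le_rfl, inner_smul_left, inner_smul_right]
    simp only [neg_zero, zpow_zero, one_smul, RCLike.conj_to_real]
    rw [← mul_assoc, zpow_neg, inv_mul_cancel₀ h2.ne', one_mul]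
  rw [h1, Complex.smul_re, smul_eq_mul]

/-- The substitution `z ↦ 2 ^ (-j) z` cancels the dilation of the kernel. The weight no longer
depends on `j` and the translations shrink to the identity, whence both the uniform bound and the
limit. -/
theorem smoothing_kernel {j : ℤ} (hj : 0 ≤ j) (u : PlaneL2) :
    smoothing (ρ.kernel j) u = ∫ z, ρ.kernel 0 z • translate ((2 : ℝ) ^ (-j) • z) u := by
  have h2 : (0 : ℝ) < 2 ^ j := by positivity
  have h := Measure.integral_comp_smul (volume : Measure Plane)
    (fun z : Plane => ρ.kernel j z • translate z u) ((2 : ℝ) ^ (-j))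
  have h3 : |(((2 : ℝ) ^ (-j)) ^ Module.finrank ℝ Plane)⁻¹| = ((2 : ℝ) ^ j) ^ 2 := by
    rw [finrank_euclideanSpace, Fintype.card_fin, zpow_neg, inv_pow, inv_inv,
      abs_of_pos (by positivity)]
  rw [h3] at h
  have h4 : ∀ z : Plane, ρ.kernel j ((2 : ℝ) ^ (-j) • z) = ((2 : ℝ) ^ j) ^ 2 * ρ.kernel 0 z := by
    intro z
    rw [ρ.kernel_eq hj, smul_smul, zpow_neg, mul_inv_cancel₀ h2.ne', one_smul]
  simp_rw [h4, mul_smul] at h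
  rw [integral_smul] at h
  exact (smul_right_injective PlaneL2 (by positivity : ((2 : ℝ) ^ j) ^ 2 ≠ 0) h).symm

theorem norm_smoothing_kernel_le {j : ℤ} (hj : 0 ≤ j) (u : PlaneL2) :
    ‖smoothing (ρ.kernel j) u‖ ≤ (∫ z, ‖ρ.kernel 0 z‖) * ‖u‖ := by
  rw [ρ.smoothing_kernel hj]
  refine (norm_integral_le_integral_norm _).trans_eq ?_
  simp_rw [norm_smul, norm_translate]
  rw [integral_mul_const]

/-- Dominated convergence with strong continuity of translations. Only existence of a limit matters
later, so the total mass of the kernel is left unevaluated. -/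
theorem tendsto_smoothing_kernel (u : PlaneL2) :
    Tendsto (fun j : ℤ => smoothing (ρ.kernel j) u) atTop (𝓝 ((∫ z, ρ.kernel 0 z) • u)) := by
  have hpow : Tendsto (fun j : ℤ => (2 : ℝ) ^ (-j)) atTop (𝓝 0) := by
    have h1 : Tendsto Int.toNat atTop atTop := tendsto_atTop.2 fun n => by
      filter_upwards [eventually_ge_atTop (n : ℤ)] with j hj
      omega
    refine ((tendsto_pow_atTop_nhds_zero_of_lt_one (r := (1 / 2 : ℝ)) (by norm_num)
      (by norm_num)).comp h1).congr' ?_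
    filter_upwards [eventually_ge_atTop 0] with j hj
    obtain ⟨n, rfl⟩ := Int.eq_ofNat_of_zero_le hj
    simp
  have h : Tendsto (fun j : ℤ => ∫ z, ρ.kernel 0 z • translate ((2 : ℝ) ^ (-j) • z) u) atTop
      (𝓝 (∫ z, ρ.kernel 0 z • u)) := by
    have hκ := (ρ.kernel 0).integrable (μ := volume)
    refine tendsto_integral_filter_of_dominated_convergence (fun z => ‖ρ.kernel 0 z‖ * ‖u‖)
      (Eventually.of_forall fun j =>
        (integrable_smoothing hκ (continuous_const_smul _) u).aestronglyMeasurable)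
      (Eventually.of_forall fun j => Eventually.of_forall fun z => ?_)
      (hκ.norm.mul_const _) (Eventually.of_forall fun z => ?_)
    · rw [norm_smul, norm_translate]
    · refine Tendsto.const_smul ?_ _
      have h2 : Tendsto (fun j : ℤ => (2 : ℝ) ^ (-j) • z) atTop (𝓝 0) := by
        simpa using hpow.smul_const z
      have h3 := ((continuous_translate u).tendsto 0).comp h2
      rwa [translate_zero] at h3
  rw [integral_smul_const] at h
  refine h.congr' ?_
  filter_upwards [eventually_ge_atTop 0] with j hj
  rw [ρ.smoothing_kernel hj]

end LPCutoff

/-! ### Step functions -/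

/-- The signed indicator function that represents the integral from `a` to `b`. -/
noncomputable def signedIndicator (a b : ℝ) : ℝ → ℝ :=
  (Set.uIoc a b).indicator fun _ => if a ≤ b then 1 else -1

theorem measurable_signedIndicator (a b : ℝ) : Measurable (signedIndicator a b) :=
  measurable_const.indicator measurableSet_uIoc

theorem abs_signedIndicator_le (a b t : ℝ) : |signedIndicator a b t| ≤ 1 := by
  unfold signedIndicator Set.indicator
  split_ifs <;> simp

theorem sq_signedIndicator (a b t : ℝ) :
    signedIndicator a b t ^ 2 = (Set.uIoc a b).indicator 1 t := by
  unfold signedIndicator Set.indicator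
  split_ifs <;> simp

theorem uIoc_subset_Icc {a b : ℝ} (ha : a ∈ Set.Icc (0 : ℝ) 1) (hb : b ∈ Set.Icc (0 : ℝ) 1) :
    Set.uIoc a b ⊆ Set.Icc 0 1 := fun _ hx =>
  ⟨(le_min ha.1 hb.1).trans hx.1.le, hx.2.trans (max_le ha.2 hb.2)⟩

theorem integral_signedIndicator_smul {E : Type*} [NormedAddCommGroup E] [NormedSpace ℝ E]
    {a b : ℝ} (ha : a ∈ Set.Icc (0 : ℝ) 1) (hb : b ∈ Set.Icc (0 : ℝ) 1) (f : ℝ → E) :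
    ∫ t in Set.Icc (0 : ℝ) 1, signedIndicator a b t • f t = ∫ t in a..b, f t := by
  rw [intervalIntegral.intervalIntegral_eq_integral_uIoc, ← integral_smul]
  have h1 : (fun t => signedIndicator a b t • f t) = (Set.uIoc a b).indicator
      fun t => (if a ≤ b then (1 : ℝ) else -1) • f t := by
    ext t
    unfold signedIndicator
    by_cases ht : t ∈ Set.uIoc a b
    · simp only [Set.indicator_of_mem ht]
    · simp only [Set.indicator_of_notMem ht, zero_smul]
  rw [h1, setIntegral_indicator measurableSet_uIoc,
    Set.inter_eq_right.2 (uIoc_subset_Icc ha hb)]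

theorem integral_sq_signedIndicator {a b : ℝ} (ha : a ∈ Set.Icc (0 : ℝ) 1)
    (hb : b ∈ Set.Icc (0 : ℝ) 1) :
    ∫ t in Set.Icc (0 : ℝ) 1, signedIndicator a b t ^ 2 = |b - a| := by
  simp_rw [sq_signedIndicator]
  rw [setIntegral_indicator measurableSet_uIoc, Set.inter_eq_right.2 (uIoc_subset_Icc ha hb)]
  simp [Set.uIoc, max_sub_min_eq_abs]

/-- The affine parametrization of the segment from `s` to `t`. -/
def segment (s t u : ℝ) : ℝ := s + (t - s) * u

theorem segment_mem {s t u : ℝ} (hs : s ∈ Set.Icc (0 : ℝ) 1) (ht : t ∈ Set.Icc (0 : ℝ) 1)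
    (hu : u ∈ Set.Icc (0 : ℝ) 1) : segment s t u ∈ Set.Icc (0 : ℝ) 1 := by
  obtain ⟨hs0, hs1⟩ := hs
  obtain ⟨ht0, ht1⟩ := ht
  obtain ⟨hu0, hu1⟩ := hu
  unfold segment
  constructor <;> nlinarith

theorem pairwise_disjoint_segment (s t : ℝ) (N : ℕ) :
    Pairwise (Function.onFun Disjoint fun i : ℕ =>
      Set.uIoc (segment s t (i / N)) (segment s t ((i + 1 : ℕ) / N))) := by
  rcases le_total s t with h | h
  · have hm : Monotone fun i : ℕ => segment s t (i / N) := fun i k hik => by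
      unfold segment
      have : (i : ℝ) ≤ k := by exact_mod_cast hik
      have := sub_nonneg.2 h
      simp only
      gcongr
    refine (hm.pairwise_disjoint_on_Ioc_succ).mono fun i k hik => ?_
    simp only [Function.onFun, Order.succ_eq_add_one] at hik ⊢
    rwa [Set.uIoc_of_le (hm i.le_succ), Set.uIoc_of_le (hm k.le_succ)]
  · have hm : Antitone fun i : ℕ => segment s t (i / N) := fun i k hik => by
      unfold segment
      have h1 : (i : ℝ) ≤ k := by exact_mod_cast hik
      have h2 : (i : ℝ) / N ≤ k / N := by gcongr
      simp only
      nlinarith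
    refine (hm.pairwise_disjoint_on_Ioc_succ).mono fun i k hik => ?_
    simp only [Function.onFun, Order.succ_eq_add_one] at hik ⊢
    rwa [Set.uIoc_of_ge (hm i.le_succ), Set.uIoc_of_ge (hm k.le_succ)]

/-- The cells are disjoint for either orientation of the segment, so at most one term is nonzero at
each `x` and all cross terms vanish. -/
theorem sq_sum_signedIndicator (s t : ℝ) (N n : ℕ) (a : ℕ → ℝ) (x : ℝ) :
    (∑ i ∈ Finset.range n, a i *
      signedIndicator (segment s t (i / N)) (segment s t ((i + 1 : ℕ) / N)) x) ^ 2 =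
    ∑ i ∈ Finset.range n, a i ^ 2 *
      signedIndicator (segment s t (i / N)) (segment s t ((i + 1 : ℕ) / N)) x ^ 2 := by
  set I : ℕ → Set ℝ := fun i => Set.uIoc (segment s t (i / N)) (segment s t ((i + 1 : ℕ) / N))
  have hd := pairwise_disjoint_segment s t N
  have hz : ∀ i, x ∉ I i →
      signedIndicator (segment s t (i / N)) (segment s t ((i + 1 : ℕ) / N)) x = 0 :=
    fun i hi => Set.indicator_of_notMem hi _
  by_cases h : ∃ i ∈ Finset.range n, x ∈ I i
  · obtain ⟨i, hi, hx⟩ := h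
    have hne : ∀ k, k ≠ i →
        signedIndicator (segment s t (k / N)) (segment s t ((k + 1 : ℕ) / N)) x = 0 :=
      fun k hk => hz k fun hxk => Set.disjoint_left.1 (hd hk) hxk hx
    rw [Finset.sum_eq_single_of_mem i hi fun k _ hk => by rw [hne k hk, mul_zero],
      Finset.sum_eq_single_of_mem i hi fun k _ hk => by rw [hne k hk]; simp, mul_pow]
  · push Not at h
    rw [Finset.sum_eq_zero fun i hi => by rw [hz i (h i hi), mul_zero],
      Finset.sum_eq_zero fun i hi => by rw [hz i (h i hi)]; simp]
    simp

/-- The velocity, reparametrized along the segment from `s` to `t`. -/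
noncomputable def segmentVelocity (κ : 𝓢(Plane, ℝ)) (c : ℝ → Plane) (s t u : ℝ) : PlaneL2 :=
  (t - s) • velocity κ c (segment s t u)

theorem continuous_segment (s t : ℝ) : Continuous (segment s t) := by
  unfold segment
  fun_prop

theorem integral_comp_segment {E : Type*} [NormedAddCommGroup E] [NormedSpace ℝ E]
    (f : ℝ → E) (s t a b : ℝ) :
    ∫ u in a..b, (t - s) • f (segment s t u) = ∫ τ in segment s t a..segment s t b, f τ := by
  unfold segment
  rw [intervalIntegral.integral_smul, intervalIntegral.smul_integral_comp_add_mul]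

/-! ### Step bound and limits for the smoothed velocities -/

section

variable {c : ℝ → Plane} {s t : ℝ}

/-- The weighted sum of increments is the integral of a step function against the velocity, hence a
smoothing of its image under the operator of the curve. The `L²` bound of that operator is applied
to the step function, whose cells have length `|t - s| / N`. The constant `C` depends on neither `κ`
nor `N`. -/
theorem exists_stepBound (hc : c ∈ CurvesInfty) (hs : s ∈ Set.Icc (0 : ℝ) 1)
    (ht : t ∈ Set.Icc (0 : ℝ) 1) : ∃ C : ℝ, 0 ≤ C ∧ ∀ (κ : 𝓢(Plane, ℝ)) (L : ℝ), 0 ≤ L →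
      (∀ u, ‖smoothing κ u‖ ≤ L * ‖u‖) → StepBound (segmentVelocity κ c s t) (L ^ 2 * C) := by
  obtain ⟨C, hC, hE⟩ := exists_image_norm_le hc
  refine ⟨C, hC, fun κ L hL hκ N hN a => ?_⟩
  have hN0 : (0 : ℝ) < N := by exact_mod_cast Nat.pos_of_ne_zero hN
  set r : ℕ → ℝ := fun i => segment s t (i / N) with hr
  have hrm : ∀ i, i ≤ N → r i ∈ Set.Icc (0 : ℝ) 1 := fun i hi =>
    segment_mem hs ht ⟨by positivity, div_le_one_of_le₀ (by exact_mod_cast hi) hN0.le⟩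
  set h : ℝ → ℝ := fun τ => ∑ i ∈ Finset.range N, a i * signedIndicator (r i) (r (i + 1)) τ with hh
  have hhm : Measurable h := Finset.measurable_fun_sum _ fun i _ =>
    (measurable_signedIndicator _ _).const_mul _
  have hhb : ∀ τ, |h τ| ≤ ∑ i ∈ Finset.range N, |a i| := fun τ => by
    refine (Finset.abs_sum_le_sum_abs _ _).trans (Finset.sum_le_sum fun i _ => ?_)
    rw [abs_mul]
    exact mul_le_of_le_one_right (abs_nonneg _) (abs_signedIndicator_le _ _ _)
  obtain ⟨u, hu, hun⟩ := hE h hhm _ hhb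
  have hvel := continuous_velocity κ hc.1
  have hint : ∀ i, IntegrableOn (fun τ => signedIndicator (r i) (r (i + 1)) τ • velocity κ c τ)
      (Set.Icc (0 : ℝ) 1) := fun i =>
    Integrable.bdd_smul (hvel.continuousOn.integrableOn_compact isCompact_Icc) 1
      (measurable_signedIndicator _ _).aestronglyMeasurable
      (Eventually.of_forall (abs_signedIndicator_le _ _))
  have e1 : ∑ i ∈ Finset.range N, a i • ∫ u in ((i : ℝ) / N)..((i + 1 : ℕ) / N),
      segmentVelocity κ c s t u = ∫ τ in Set.Icc (0 : ℝ) 1, h τ • velocity κ c τ := by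
    simp only [hh, Finset.sum_smul, mul_smul]
    have hint' : ∀ i ∈ Finset.range N, IntegrableOn
        (fun τ => a i • signedIndicator (r i) (r (i + 1)) τ • velocity κ c τ)
        (Set.Icc (0 : ℝ) 1) := fun i _ => (hint i).smul (a i)
    rw [integral_finsetSum _ hint']
    refine Finset.sum_congr rfl fun i hi => ?_
    have hi' := Finset.mem_range.1 hi
    rw [integral_smul, integral_signedIndicator_smul (hrm i hi'.le) (hrm (i + 1) hi')]
    unfold segmentVelocity
    rw [integral_comp_segment]
  rw [e1, integral_smul_velocity κ hc.1 hhm hhb hu]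
  have e2 : ∫ τ in Set.Icc (0 : ℝ) 1, h τ ^ 2 ≤ (∑ i ∈ Finset.range N, a i ^ 2) / N := by
    have h1 : ∀ τ, h τ ^ 2 = ∑ i ∈ Finset.range N, a i ^ 2 *
        signedIndicator (r i) (r (i + 1)) τ ^ 2 := fun τ => sq_sum_signedIndicator s t N N a τ
    simp_rw [h1]
    rw [integral_finsetSum, Finset.sum_div]
    · refine Finset.sum_le_sum fun i hi => ?_
      have hi' := Finset.mem_range.1 hi
      rw [integral_const_mul, integral_sq_signedIndicator (hrm i hi'.le) (hrm (i + 1) hi'),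
        div_eq_mul_one_div]
      gcongr
      have h2 : r (i + 1) - r i = (t - s) * (1 / N) := by
        simp only [hr, segment]; push_cast; ring
      rw [h2, abs_mul, abs_of_pos (by positivity : (0 : ℝ) < 1 / N)]
      have h3 : |t - s| ≤ 1 := abs_le.2 ⟨by linarith [hs.2, ht.1], by linarith [hs.1, ht.2]⟩
      exact mul_le_of_le_one_left (by positivity) h3
    · intro i _
      refine Integrable.const_mul ?_ _
      refine Integrable.of_bound (C := 1)
        ((measurable_signedIndicator _ _).pow_const 2).aestronglyMeasurable
        (Eventually.of_forall fun τ => ?_)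
      rw [norm_pow]
      exact pow_le_one₀ (norm_nonneg _) (abs_signedIndicator_le _ _ _)
  calc ‖smoothing κ u‖ ^ 2 ≤ (L * ‖u‖) ^ 2 := by gcongr; exact hκ u
    _ = L ^ 2 * ‖u‖ ^ 2 := by ring
    _ ≤ L ^ 2 * (C * ((∑ i ∈ Finset.range N, a i ^ 2) / N)) := by
        gcongr
        exact hun.trans (by gcongr)
    _ = _ := by ring

/-- Each integral is the smoothing by the `j`-th kernel of one fixed vector `w u`, the image of the
signed indicator of a segment. -/
theorem exists_tendsto_segmentVelocity (ρ : LPCutoff) (hc : c ∈ CurvesInfty)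
    (hs : s ∈ Set.Icc (0 : ℝ) 1) (ht : t ∈ Set.Icc (0 : ℝ) 1) :
    ∃ F : ℝ → PlaneL2, ∀ u ∈ Set.Icc (0 : ℝ) 1,
      Tendsto (fun j : ℤ => ∫ τ in (0 : ℝ)..u, segmentVelocity (ρ.kernel j) c s t τ) atTop
        (𝓝 (F u)) := by
  obtain ⟨C, hC, hE⟩ := exists_image_norm_le hc
  choose w hw _ using fun u : ℝ => hE (signedIndicator (segment s t 0) (segment s t u))
    (measurable_signedIndicator _ _) 1 (abs_signedIndicator_le _ _)
  refine ⟨fun u => (∫ z, ρ.kernel 0 z) • w u, fun u hu => ?_⟩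
  refine (ρ.tendsto_smoothing_kernel (w u)).congr fun j => ?_
  unfold segmentVelocity
  rw [integral_comp_segment, ← integral_smul_velocity (ρ.kernel j) hc.1
    (measurable_signedIndicator _ _) (abs_signedIndicator_le _ _) (hw u),
    integral_signedIndicator_smul (segment_mem hs ht (by simp)) (segment_mem hs ht hu)]

end

/-! ### Continuity of translations in the Schwartz space -/

/-- Mean value inequality for the `n`-th derivative between `y - x₀` and `y - x`, at the price of
one more derivative. -/
theorem seminorm_compSubConst_sub_le (ψ : 𝓢(Plane, ℝ)) (x₀ : Plane) (k n : ℕ) :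
    ∃ C : ℝ, 0 ≤ C ∧ ∀ x, ‖x - x₀‖ ≤ 1 → SchwartzMap.seminorm ℝ k n
      (SchwartzMap.compSubConstCLM ℝ x ψ - SchwartzMap.compSubConstCLM ℝ x₀ ψ) ≤
        C * ‖x - x₀‖ := by
  set S : ℝ := 2 ^ k * ((Finset.Iic (k, n + 1)).sup
    fun m => SchwartzMap.seminorm ℝ m.1 m.2) ψ with hS
  have hS0 : 0 ≤ S := by positivity
  have hdecay : ∀ z, (1 + ‖z‖) ^ k * ‖iteratedFDeriv ℝ (n + 1) ψ z‖ ≤ S := fun z =>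
    SchwartzMap.one_add_le_sup_seminorm_apply (m := (k, n + 1)) le_rfl le_rfl ψ z
  set R : ℝ := ‖x₀‖ + 1 with hR
  have hR0 : 0 ≤ R := by positivity
  refine ⟨(1 + R) ^ k * S, by positivity, fun x hx => ?_⟩
  refine SchwartzMap.seminorm_le_bound ℝ k n _ (by positivity) fun y => ?_
  have hsm : ∀ a : Plane, ContDiffAt ℝ n (fun y => ψ (y - a)) y := fun a =>
    ((ψ.smooth n).comp (contDiff_id.sub contDiff_const)).contDiffAt
  have h1 : iteratedFDeriv ℝ n
      (⇑(SchwartzMap.compSubConstCLM ℝ x ψ - SchwartzMap.compSubConstCLM ℝ x₀ ψ)) y =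
      iteratedFDeriv ℝ n ψ (y - x) - iteratedFDeriv ℝ n ψ (y - x₀) := by
    have h2 : (⇑(SchwartzMap.compSubConstCLM ℝ x ψ - SchwartzMap.compSubConstCLM ℝ x₀ ψ)) =
        (fun y => ψ (y - x)) - fun y => ψ (y - x₀) := rfl
    rw [h2, iteratedFDeriv_sub_apply (hsm x) (hsm x₀), iteratedFDeriv_comp_sub, iteratedFDeriv_comp_sub]
  rw [h1]
  -- Points of this segment lie within `R = ‖x₀‖ + 1` of `y`, so the weights at `y` and `z` differ
  -- by at most the factor `(1 + R) ^ k`.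
  have hbound : ∀ z ∈ _root_.segment ℝ (y - x₀) (y - x), ‖fderiv ℝ (iteratedFDeriv ℝ n ψ) z‖ ≤
      (1 + R) ^ k * S / (1 + ‖y‖) ^ k := by
    intro z hz
    have hzy : ‖y‖ ≤ ‖z‖ + R := by
      have h3 : z ∈ Metric.closedBall (y - x₀) 1 := by
        refine (convex_closedBall (y - x₀) 1).segment_subset (by simp) ?_ hz
        rw [mem_closedBall_iff_norm, sub_sub_sub_cancel_left, norm_sub_rev]
        exact hx
      rw [mem_closedBall_iff_norm] at h3
      calc ‖y‖ = ‖z - (z - (y - x₀)) + x₀‖ := by congr 1; abel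
        _ ≤ ‖z‖ + ‖z - (y - x₀)‖ + ‖x₀‖ :=
          (norm_add_le _ _).trans (add_le_add_left (norm_sub_le _ _) _)
        _ ≤ ‖z‖ + R := by rw [hR]; linarith
    rw [norm_fderiv_iteratedFDeriv, le_div_iff₀ (by positivity)]
    calc ‖iteratedFDeriv ℝ (n + 1) ψ z‖ * (1 + ‖y‖) ^ k
        ≤ ‖iteratedFDeriv ℝ (n + 1) ψ z‖ * ((1 + R) * (1 + ‖z‖)) ^ k := by
          gcongr
          nlinarith [norm_nonneg z]
      _ = (1 + R) ^ k * ((1 + ‖z‖) ^ k * ‖iteratedFDeriv ℝ (n + 1) ψ z‖) := by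
          rw [mul_pow]; ring
      _ ≤ (1 + R) ^ k * S := by gcongr; exact hdecay z
  have hmv := (convex_segment (y - x₀) (y - x)).norm_image_sub_le_of_norm_fderiv_le
    (f := iteratedFDeriv ℝ n ψ) (𝕜 := ℝ)
    (fun z _ => ((ψ.smooth (n + 1 : ℕ)).differentiable_iteratedFDeriv
      (by exact_mod_cast n.lt_succ_self)) z)
    hbound (left_mem_segment ℝ _ _) (right_mem_segment ℝ _ _)
  rw [sub_sub_sub_cancel_left, norm_sub_rev x₀ x] at hmv
  calc ‖y‖ ^ k * ‖iteratedFDeriv ℝ n ψ (y - x) - iteratedFDeriv ℝ n ψ (y - x₀)‖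
      ≤ (1 + ‖y‖) ^ k * ((1 + R) ^ k * S / (1 + ‖y‖) ^ k * ‖x - x₀‖) := by
        gcongr
        linarith
    _ = (1 + R) ^ k * S * ‖x - x₀‖ := by
        field_simp

theorem continuous_compSubConst (ψ : 𝓢(Plane, ℝ)) :
    Continuous fun x => SchwartzMap.compSubConstCLM ℝ x ψ := by
  rw [continuous_iff_continuousAt]
  intro x₀
  rw [ContinuousAt, (schwartz_withSeminorms ℝ Plane ℝ).tendsto_nhds]
  rintro ⟨k, n⟩ ε hε
  obtain ⟨C, hC, hb⟩ := seminorm_compSubConst_sub_le ψ x₀ k n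
  have hball : Metric.ball x₀ (min 1 (ε / (C + 1))) ∈ 𝓝 x₀ :=
    Metric.ball_mem_nhds _ (by positivity)
  filter_upwards [hball] with x hx
  rw [mem_ball_iff_norm, lt_min_iff] at hx
  refine (hb x hx.1.le).trans_lt ?_
  have h1 := hx.2
  rw [lt_div_iff₀ (by positivity)] at h1
  nlinarith [norm_nonneg (x - x₀)]

theorem continuous_reflectedShift (κ : 𝓢(Plane, ℝ)) : Continuous (reflectedShift κ) :=
  continuous_compSubConst _

/-! ### White noise and its smoothings -/

section Noise

variable {n : ℕ} {Ω : Type*} [MeasurableSpace Ω] {P : Measure Ω}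
  {W : Lp ℝ 2 (volume : Measure Plane) → Ω → Su n}

theorem IsWhiteNoise.isIsonormal (hW : IsWhiteNoise P W) {e : Su n} (he : ‖e‖ = 1) :
    IsIsonormal P fun f ω => inner ℝ (W f ω) e where
  law f := hW.gaussian.hasGaussianLaw_eval (f, e)
  centered f := hW.centered f e
  covariance f g := by
    rw [hW.covariance, real_inner_self_eq_norm_sq, he, one_pow, mul_one]

/-- The two components are jointly Gaussian, being subfamilies of one Gaussian process, and
orthogonality of `e` and `e'` makes them uncorrelated. -/
theorem IsWhiteNoise.indepFun [IsProbabilityMeasure P] (hW : IsWhiteNoise P W) {e e' : Su n}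
    (he : ‖e‖ = 1) (he' : ‖e'‖ = 1) (hee' : inner ℝ e e' = 0) :
    IndepFun (fun ω f => inner ℝ (W f ω) e) (fun ω f => inner ℝ (W f ω) e') P := by
  have h1 := hW.isIsonormal he
  have h2 := hW.isIsonormal he'
  have hG := hW.gaussian.comp_right (Sum.elim (fun f => (f, e)) fun f => (f, e'))
  refine IsGaussianProcess.indepFun_of_covariance_eq_zero (X := fun f ω => inner ℝ (W f ω) e)
    (Y := fun f ω => inner ℝ (W f ω) e') ?_ h1.aemeasurable h2.aemeasurable fun f g => ?_
  · convert! hG using 1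
    ext q ω
    cases q <;> rfl
  · rw [covariance_eq_sub (h1.memLp f (by simp)) (h2.memLp g (by simp)), h1.centered f, zero_mul,
      sub_zero]
    have := hW.covariance f g e e'
    rw [hee', mul_zero] at this
    exact this

variable (ρ : LPCutoff)

/-- Each realization is a tempered distribution, and the translated kernel moves continuously in the
Schwartz space. This holds for every `ω`, which makes all path integrals classical. -/
theorem IsWhiteNoise.continuous_smoothedNoise (hW : IsWhiteNoise P W) (j : ℤ) (ω : Ω) :
    Continuous (smoothedNoise ρ W j ω) := by
  obtain ⟨T, hT⟩ := hW.tempered ω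
  have h : smoothedNoise ρ W j ω = fun x => T (reflectedShift (ρ.kernel j) x) :=
    funext fun x => (hT _).symm
  rw [h]
  exact T.continuous.comp (continuous_reflectedShift _)

/-- The derivative of the smoothed path. -/
noncomputable def noiseVelocity (W : Lp ℝ 2 (volume : Measure Plane) → Ω → Su n)
    (c : ℝ → Plane) (j : ℤ) (ω : Ω) (t : ℝ) : Su n :=
  deriv c t 1 • ∫ ξ in (0 : ℝ)..c t 0, smoothedNoise ρ W j ω !₂[ξ, c t 1]

variable {c : ℝ → Plane}

theorem continuous_noiseVelocity (hW : IsWhiteNoise P W) (hc : c ∈ Curves) (j : ℤ) (ω : Ω) :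
    Continuous (noiseVelocity ρ W c j ω) := by
  have hc0 := Curves.continuous hc
  refine (Curves.continuous_deriv hc).smul ?_
  refine intervalIntegral.continuous_parametric_intervalIntegral_of_continuous
    (f := fun t ξ => smoothedNoise ρ W j ω !₂[ξ, c t 1]) ?_ (by fun_prop)
  refine (hW.continuous_smoothedNoise ρ j ω).comp (f := fun p : ℝ × ℝ => !₂[p.2, c p.1 1]) ?_
  fun_prop

omit [MeasurableSpace Ω] in
theorem path_eq (W : Lp ℝ 2 (volume : Measure Plane) → Ω → Su n) (c : ℝ → Plane) (j : ℤ) (ω : Ω)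
    (t : ℝ) : path ρ W c j ω t = ∫ τ in (0 : ℝ)..t, noiseVelocity ρ W c j ω τ := by
  unfold path lineIntegral axialField noiseVelocity
  simp [Fin.sum_univ_two]

instance instCompleteSpaceSu : CompleteSpace (Su n) := FiniteDimensional.complete ℝ (Su n)

theorem deriv_path (hW : IsWhiteNoise P W) (hc : c ∈ Curves) (j : ℤ) (ω : Ω) (t : ℝ) :
    deriv (path ρ W c j ω) t = noiseVelocity ρ W c j ω t := by
  have h : path ρ W c j ω = fun t => ∫ τ in (0 : ℝ)..t, noiseVelocity ρ W c j ω τ :=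
    funext (path_eq ρ W c j ω)
  rw [h]
  exact (continuous_noiseVelocity ρ hW hc j ω).deriv_integral _ 0 t

/-- A component of the derivative of the smoothed path, reparametrized along a segment. -/
noncomputable def noiseComponent (W : Lp ℝ 2 (volume : Measure Plane) → Ω → Su n)
    (c : ℝ → Plane) (s t : ℝ) (e : Su n) (j : ℤ) (u : ℝ) (ω : Ω) : ℝ :=
  inner ℝ ((t - s) • noiseVelocity ρ W c j ω (segment s t u)) e

theorem continuous_noiseComponent (hW : IsWhiteNoise P W) (hc : c ∈ Curves) (s t : ℝ)
    (e : Su n) (j : ℤ) (ω : Ω) : Continuous fun u => noiseComponent ρ W c s t e j u ω := by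
  have h1 : Continuous fun u => noiseVelocity ρ W c j ω (segment s t u) :=
    (continuous_noiseVelocity ρ hW hc j ω).comp (continuous_segment s t)
  have h2 : Continuous fun u => (t - s) • noiseVelocity ρ W c j ω (segment s t u) :=
    h1.const_smul (t - s)
  exact h2.inner continuous_const

theorem noiseComponent_eq (hW : IsWhiteNoise P W) (s t : ℝ) (e : Su n) (j : ℤ) (u : ℝ) (ω : Ω) :
    noiseComponent ρ W c s t e j u ω = ((t - s) * deriv c (segment s t u) 1) *
      ∫ ξ in (0 : ℝ)..c (segment s t u) 0,
        inner ℝ (smoothedNoise ρ W j ω !₂[ξ, c (segment s t u) 1]) e := by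
  have hline : Continuous fun ξ : ℝ => (!₂[ξ, c (segment s t u) 1] : Plane) := by fun_prop
  have h4 : Continuous fun ξ => smoothedNoise ρ W j ω !₂[ξ, c (segment s t u) 1] :=
    (hW.continuous_smoothedNoise ρ j ω).comp hline
  have h5 := (innerSL ℝ e).intervalIntegral_comp_comm
    (h4.intervalIntegrable (μ := volume) 0 (c (segment s t u) 0))
  simp only [innerSL_apply_apply] at h5
  unfold noiseComponent noiseVelocity
  rw [smul_smul, real_inner_smul_left, real_inner_comm, ← h5]
  simp only [real_inner_comm]

/-- The pathwise integral over the horizontal line may be moved inside the noise by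
`IsIsonormal.integral_ae`. -/
theorem noiseComponent_ae_eq (hW : IsWhiteNoise P W) (s t : ℝ) {e : Su n} (he : ‖e‖ = 1)
    (j : ℤ) (u : ℝ) : noiseComponent ρ W c s t e j u =ᵐ[P]
      fun ω => inner ℝ (W (segmentVelocity (ρ.kernel j) c s t u) ω) e := by
  have hV := hW.isIsonormal he
  have hline : Continuous fun ξ : ℝ => (!₂[ξ, c (segment s t u) 1] : Plane) := by fun_prop
  have h1 := hV.integral_ae
    (φ := fun ξ => shiftL2 (ρ.kernel j) !₂[ξ, c (segment s t u) 1])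
    (Y := fun ξ ω => inner ℝ (smoothedNoise ρ W j ω !₂[ξ, c (segment s t u) 1]) e)
    ((continuous_shiftL2 _).comp hline)
    (fun ω => ((hW.continuous_smoothedNoise ρ j ω).comp hline).inner continuous_const)
    (fun ξ => EventuallyEq.rfl) 0 (c (segment s t u) 0)
  have h2 := hV.smul_ae ((t - s) * deriv c (segment s t u) 1)
    (∫ ξ in (0 : ℝ)..c (segment s t u) 0, shiftL2 (ρ.kernel j) !₂[ξ, c (segment s t u) 1])
  have h3 : segmentVelocity (ρ.kernel j) c s t u = ((t - s) * deriv c (segment s t u) 1) •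
      ∫ ξ in (0 : ℝ)..c (segment s t u) 0,
        shiftL2 (ρ.kernel j) !₂[ξ, c (segment s t u) 1] := by
    unfold segmentVelocity velocity
    rw [smul_smul]
  rw [h3]
  filter_upwards [h1, h2] with ω a1 a2
  rw [a2, ← a1, noiseComponent_eq ρ hW]

theorem isContinuousVersion_noiseComponent (hW : IsWhiteNoise P W) (hc : c ∈ Curves) (s t : ℝ)
    {e : Su n} (he : ‖e‖ = 1) (j : ℤ) :
    IsContinuousVersion P (fun f ω => inner ℝ (W f ω) e)
      (segmentVelocity (ρ.kernel j) c s t) (noiseComponent ρ W c s t e j) where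
  continuous_index := by
    have h1 : Continuous fun u => velocity (ρ.kernel j) c (segment s t u) :=
      (continuous_velocity _ hc).comp (continuous_segment s t)
    exact h1.const_smul (t - s)
  continuous_path := continuous_noiseComponent ρ hW hc s t e j
  ae_eq := noiseComponent_ae_eq ρ hW s t he j

/-- The affine substitution carries the integral to `[0, 1]` for any order of `s` and `t`. One
factor `t - s` is absorbed into the velocity, another arises in the inner primitive. -/
theorem secondLevel_eq (hW : IsWhiteNoise P W) (hc : c ∈ Curves) (s t : ℝ)
    {ι : Type*} [Fintype ι] (b : OrthonormalBasis ι ℝ (Su n)) (j : ℤ) (ω : Ω) :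
    secondLevel ρ W c j s t ω = ∑ k, ∑ l,
      iterated (noiseComponent ρ W c s t (b k) j · ω) (noiseComponent ρ W c s t (b l) j · ω) •
        (b k ⊗ₜ[ℝ] b l) := by
  set v := noiseVelocity ρ W c j ω with hv
  have hvc : Continuous v := continuous_noiseVelocity ρ hW hc j ω
  set w : ℝ → Su n := fun u => (t - s) • v (segment s t u) with hw
  have hwc : Continuous w :=
    (hvc.comp (continuous_segment s t)).const_smul (t - s)
  have hint : ∀ a b, IntervalIntegrable v volume a b := fun a b => hvc.intervalIntegrable _ _
  have e0 : segment s t 0 = s := by simp [segment]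
  have e1 : segment s t 1 = t := by simp [segment]
  have h1 : secondLevel ρ W c j s t ω =
      ∫ u in (0 : ℝ)..1, (∫ τ in (0 : ℝ)..u, w τ) ⊗ₜ[ℝ] w u := by
    have h2 := integral_comp_segment (fun r =>
      ((∫ τ in (0 : ℝ)..r, v τ) - ∫ τ in (0 : ℝ)..s, v τ) ⊗ₜ[ℝ] v r) s t 0 1
    rw [e0, e1] at h2
    unfold secondLevel
    simp_rw [deriv_path ρ hW hc, path_eq]
    refine h2.symm.trans (intervalIntegral.integral_congr fun u _ => ?_)
    have h3 := integral_comp_segment v s t 0 u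
    rw [e0] at h3
    rw [intervalIntegral.integral_interval_sub_left (hint _ _) (hint _ _),
      ← TensorProduct.tmul_smul, ← h3]
  have hx : ∀ k u, inner ℝ (∫ τ in (0 : ℝ)..u, w τ) (b k) =
      ∫ τ in (0 : ℝ)..u, noiseComponent ρ W c s t (b k) j τ ω := by
    intro k u
    have h5 := (innerSL ℝ (b k)).intervalIntegral_comp_comm
      (hwc.intervalIntegrable (μ := volume) 0 u)
    simp only [innerSL_apply_apply] at h5
    rw [real_inner_comm, ← h5]
    simp only [real_inner_comm]
    rfl
  have hdec : ∀ x y : Su n, x ⊗ₜ[ℝ] y =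
      ∑ k, ∑ l, (inner ℝ x (b k) * inner ℝ y (b l)) • (b k ⊗ₜ[ℝ] b l) := by
    intro x y
    conv_lhs => rw [← b.sum_repr' x, ← b.sum_repr' y, TensorProduct.sum_tmul]
    refine Finset.sum_congr rfl fun k _ => ?_
    rw [TensorProduct.tmul_sum]
    refine Finset.sum_congr rfl fun l _ => ?_
    rw [TensorProduct.tmul_smul, TensorProduct.smul_tmul', smul_smul, real_inner_comm x,
      real_inner_comm y, mul_comm, TensorProduct.smul_tmul']
  have hcont : ∀ k l, Continuous fun u => (inner ℝ (∫ τ in (0 : ℝ)..u, w τ) (b k) *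
      inner ℝ (w u) (b l)) • (b k ⊗ₜ[ℝ] b l) := by
    intro k l
    have := continuous_primitive hwc
    fun_prop
  rw [h1]
  have h2 : ∀ u, (∫ τ in (0 : ℝ)..u, w τ) ⊗ₜ[ℝ] w u = ∑ k, ∑ l,
      (inner ℝ (∫ τ in (0 : ℝ)..u, w τ) (b k) * inner ℝ (w u) (b l)) • (b k ⊗ₜ[ℝ] b l) :=
    fun u => hdec _ _
  simp only [h2]
  rw [intervalIntegral.integral_finsetSum fun k _ =>
    (continuous_finsetSum _ fun l _ => hcont k l).intervalIntegrable _ _]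
  refine Finset.sum_congr rfl fun k _ => ?_
  rw [intervalIntegral.integral_finsetSum fun l _ => (hcont k l).intervalIntegrable _ _]
  refine Finset.sum_congr rfl fun l _ => ?_
  rw [intervalIntegral.integral_smul_const]
  simp_rw [hx]
  rfl

end Noise

theorem eLpNorm_fun_sum_le {α E ι : Type*} [MeasurableSpace α] {μ : Measure α}
    [NormedAddCommGroup E] {f : ι → α → E} {S : Finset ι}
    (hf : ∀ i ∈ S, AEStronglyMeasurable (f i) μ) {p : ℝ≥0∞} (hp : 1 ≤ p) :
    eLpNorm (fun a => ∑ i ∈ S, f i a) p μ ≤ ∑ i ∈ S, eLpNorm (f i) p μ := by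
  simpa only [← Finset.sum_apply] using! eLpNorm_sum_le hf hp

/-! ### Moments and convergence of the coefficients of the second level -/

section SecondLevel

variable {n : ℕ} {Ω : Type*} [MeasurableSpace Ω] {P : Measure Ω} [IsProbabilityMeasure P]
  {W : Lp ℝ 2 (volume : Measure Plane) → Ω → Su n} (ρ : LPCutoff) {c : ℝ → Plane} {s t : ℝ}
  {ι : Type*} [Fintype ι]

theorem memLp_iterated_noiseComponent (hW : IsWhiteNoise P W) (hc : c ∈ CurvesInfty)
    (hs : s ∈ Set.Icc (0 : ℝ) 1) (ht : t ∈ Set.Icc (0 : ℝ) 1) (b : OrthonormalBasis ι ℝ (Su n))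
    (k l : ι) (j : ℤ) {p : ℝ≥0∞} (hp : 1 ≤ p) (hp' : p ≠ ∞) :
    MemLp (fun ω => iterated (noiseComponent ρ W c s t (b k) j · ω)
      (noiseComponent ρ W c s t (b l) j · ω)) p P := by
  have hV := fun i => hW.isIsonormal (b.norm_eq_one i)
  have hf := fun i => isContinuousVersion_noiseComponent ρ hW hc.1 s t (b.norm_eq_one i) j
  by_cases hkl : k = l
  · subst hkl
    exact memLp_iterated_self (hV k) (hf k) hp hp'
  -- On a probability space the norm of exponent `p` is dominated by that of the even exponent `2 *
  -- m`, where the Gaussian estimates apply.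
  obtain ⟨m, hm⟩ := ENNReal.exists_nat_gt hp'
  have hm0 : m ≠ 0 := by rintro rfl; simp at hm
  have hpm : p ≤ (2 * m : ℕ) := hm.le.trans (by exact_mod_cast (by omega : m ≤ 2 * m))
  obtain ⟨C, hC, hstep⟩ := exists_stepBound hc hs ht
  -- For a single index the `L¹` norm of its own kernel suffices; this includes `j = -1`, outside
  -- the range of the scaling.
  have hL : 0 ≤ ∫ z, ‖ρ.kernel j z‖ := integral_nonneg fun z => norm_nonneg _
  exact (memLp_iterated (hV k) (hV l)
    (hW.indepFun (b.norm_eq_one k) (b.norm_eq_one l) (b.inner_eq_zero hkl)) (hf k) (hf l)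
    (by positivity) (hstep _ _ hL (norm_smoothing_le _)) hm0).mono_exponent hpm

theorem tendsto_eLpNorm_iterated_noiseComponent_sub (hW : IsWhiteNoise P W)
    (hc : c ∈ CurvesInfty) (hs : s ∈ Set.Icc (0 : ℝ) 1) (ht : t ∈ Set.Icc (0 : ℝ) 1)
    (b : OrthonormalBasis ι ℝ (Su n)) (k l : ι) {p : ℝ≥0∞} (hp : 1 ≤ p) (hp' : p ≠ ∞) :
    Tendsto (fun q : ℤ × ℤ => eLpNorm (fun ω =>
      iterated (noiseComponent ρ W c s t (b k) q.2 · ω)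
        (noiseComponent ρ W c s t (b l) q.2 · ω) -
      iterated (noiseComponent ρ W c s t (b k) q.1 · ω)
        (noiseComponent ρ W c s t (b l) q.1 · ω)) p P) (atTop ×ˢ atTop) (𝓝 0) := by
  have hV := fun i => hW.isIsonormal (b.norm_eq_one i)
  have hf := fun i j => isContinuousVersion_noiseComponent ρ hW hc.1 s t (b.norm_eq_one i) j
  obtain ⟨F, hF⟩ := exists_tendsto_segmentVelocity ρ hc hs ht
  by_cases hkl : k = l
  · subst hkl
    exact tendsto_eLpNorm_iterated_self_sub (hV k) (hf k) (hF 1 (by simp)) hp hp'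
  obtain ⟨m, hm⟩ := ENNReal.exists_nat_gt hp'
  have hm0 : m ≠ 0 := by rintro rfl; simp at hm
  have hpm : p ≤ (2 * m : ℕ) := hm.le.trans (by exact_mod_cast (by omega : m ≤ 2 * m))
  obtain ⟨C, hC, hstep⟩ := exists_stepBound hc hs ht
  -- By scaling this one norm serves for all `j ≥ 0`.
  have hL : 0 ≤ ∫ z, ‖ρ.kernel 0 z‖ := integral_nonneg fun z => norm_nonneg _
  have h := tendsto_eLpNorm_iterated_sub (hV k) (hV l)
    (hW.indepFun (b.norm_eq_one k) (b.norm_eq_one l) (b.inner_eq_zero hkl)) (hf k) (hf l)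
    (by positivity) (fun j hj => hstep _ _ hL (ρ.norm_smoothing_kernel_le hj)) hF hm0
  refine tendsto_of_tendsto_of_tendsto_of_le_of_le tendsto_const_nhds h (fun _ => zero_le)
    fun q => eLpNorm_le_eLpNorm_of_exponent_le hpm ?_
  exact (aestronglyMeasurable_iterated (hV k) (hV l) (hf k _) (hf l _)).sub
    (aestronglyMeasurable_iterated (hV k) (hV l) (hf k _) (hf l _))

end SecondLevel

end PlanarYM

theorem proposition9p7 {n : ℕ} (ρ : PlanarYM.LPCutoff)
    {Ω : Type*} [MeasurableSpace Ω] (P : Measure Ω) [IsProbabilityMeasure P]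
    (W : Lp ℝ 2 (volume : Measure PlanarYM.Plane) → Ω → PlanarYM.Su n)
    (hW : PlanarYM.IsWhiteNoise P W)
    (c : ℝ → PlanarYM.Plane) (hc : c ∈ PlanarYM.CurvesInfty)
    (s t : ℝ) (hs : s ∈ Set.Icc (0 : ℝ) 1) (ht : t ∈ Set.Icc (0 : ℝ) 1)
    (p : ℝ≥0∞) (hp : 1 ≤ p) (hp' : p ≠ ∞) :
    (∀ j : ℤ, -1 ≤ j → MemLp (PlanarYM.secondLevel ρ W c j s t) p P) ∧
    Tendsto (fun q : ℤ × ℤ =>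
        eLpNorm (fun ω => PlanarYM.secondLevel ρ W c q.2 s t ω
          - PlanarYM.secondLevel ρ W c q.1 s t ω) p P)
      (atTop ×ˢ atTop) (𝓝 0) := by
  set b := stdOrthonormalBasis ℝ (PlanarYM.Su n) with hb
  have hdec := PlanarYM.secondLevel_eq ρ hW hc.1 s t b
  refine ⟨fun j _ => ?_, ?_⟩
  · have h : PlanarYM.secondLevel ρ W c j s t = fun ω => ∑ k, ∑ l, _ := funext (hdec j)
    rw [h]
    refine memLp_finsetSum _ fun k _ => memLp_finsetSum _ fun l _ => ?_
    exact MemLp.smul (p := p) (q := ∞) (memLp_const (b k ⊗ₜ[ℝ] b l))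
      (PlanarYM.memLp_iterated_noiseComponent ρ hW hc hs ht b k l j hp hp')
  · have hterm := fun k l =>
      PlanarYM.tendsto_eLpNorm_iterated_noiseComponent_sub ρ hW hc hs ht b k l hp hp'
    have hsum := tendsto_finsetSum Finset.univ fun k _ =>
      tendsto_finsetSum Finset.univ fun l _ => hterm k l
    simp only [Finset.sum_const_zero] at hsum
    refine tendsto_of_tendsto_of_tendsto_of_le_of_le tendsto_const_nhds hsum
      (fun _ => zero_le) fun q => ?_
    have hmem := fun k l j =>
      PlanarYM.memLp_iterated_noiseComponent ρ hW hc hs ht b k l j hp hp'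
    simp only [hdec, ← Finset.sum_sub_distrib, ← sub_smul]
    have hmeas := fun k l => (((hmem k l q.2).sub (hmem k l q.1)).aestronglyMeasurable).smul
      (aestronglyMeasurable_const (b := b k ⊗ₜ[ℝ] b l))
    refine (PlanarYM.eLpNorm_fun_sum_le (fun k _ =>
      Finset.aestronglyMeasurable_fun_sum _ fun l _ => hmeas k l) hp).trans ?_
    refine Finset.sum_le_sum fun k _ => ?_
    refine (PlanarYM.eLpNorm_fun_sum_le (fun l _ => hmeas k l) hp).trans ?_
    -- The tensors `b k ⊗ₜ b l` have norm one, so each summand has the norm of its scalar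
    -- coefficient.
    refine Finset.sum_le_sum fun l _ => le_of_eq (eLpNorm_congr_norm_ae ?_)
    refine Eventually.of_forall fun ω => ?_
    rw [Pi.smul_apply', norm_smul, TensorProduct.norm_tmul, b.norm_eq_one, b.norm_eq_one, mul_one, mul_one,
      Pi.sub_apply]
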